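/- **Setting.** Let $\mathcal P_2=\mathcal P_2(\mathbb R^n)$ be the space of Borel probability measures on $\mathbb R^n$ with finite second moment, with the Wasserstein distance $W_2$; all continuity in the measure argument refers to $W_2$. A *functional derivative* of $F:\mathcal P_2\to\mathbb R$ is a jointly continuous function $(m,x)\mapsto\frac{dF}{d\nu}(m)(x)$, integrable in $x$ against every element of $\mathcal P_2$, such that for all $m,m'\in\mathcal P_2$ $$\frac{F(m+\epsilon(m'-m))-F(m)}{\epsilon}\to\int\frac{dF}{d\nu}(m)(x)\,d(m'-m)(x)\qquad(\epsilon\downarrow0).$$ A *second-order functional derivative* of $F$ is a jointly continuous function $(m,x,x^1)\mapsto\frac{d^2F}{d\nu^2}(m)(x,x^1)$, integrable in $(x,x^1)$ against all products of elements of $\mathcal P_2$, such that for all $m,m'\in\mathcal P_2$ the function $\theta\mapsto F(m+\theta(m'-m))$ is twice continuously differentiable on $[0,1]$ with $$\frac{d^2}{d\theta^2}F(m+\theta(m'-m))=\iint\frac{d^2F}{d\nu^2}(m+\theta(m'-m))(x,x^1)\,d(m'-m)(x)\,d(m'-m)(x^1).$$ $D$ and $D_1$ denote the gradients with respect to $x$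 and $x^1$; $DD_1 f(x,x^1)$ is the matrix $(\partial_{x_i}\partial_{x^1_j}f)_{ij}$. Let $(\Omega,\mathcal A,\mathbb P)$ be a probability space, $\mathcal B\subset\mathcal A$ a sub-$\sigma$-algebra, $m\in\mathcal P_2$, and $\mathcal H_m=L^2(\Omega,\mathcal A,\mathbb P;L^2_m(\mathbb R^n;\mathbb R^n))$, whose elements are random fields $Z_x(\omega)$ with $\|Z\|^2=\mathbb E\int|Z_x|^2dm(x)$. For $Z\in\mathcal H_m$ let $(Z\otimes m)^{\mathcal B}$ be the $\mathcal B$-measurable random element of $\mathcal P_2$ with $$\int\varphi\,d(Z\otimes m)^{\mathcal B}=\mathbb E\Big[\int\varphi(Z_x)\,dm(x)\,\Big|\,\mathcal B\Big]\qquad\text{for all bounded Borel }\varphi .$$ A functional $\Phi:\mathcal H_m\to\mathbb R$ has *Gâteaux derivative* $D_X\Phi(Z)\in\mathcal H_m$ at $Z$ if $\epsilon^{-1}(\Phi(Z+\epsilon Y)-\Phi(Z))\to\langle D_X\Phi(Z),Y\rangle$ as $\epsilon\to0$ for all $Y\in\mathcal H_m$. It has *second-order Gâteaux derivative* $D_X^2\Phi(Z)\in\mathcal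 L(\mathcal H_m;\mathcal H_m)$ at $Z$ if it has a Gâteaux derivative everywhere and, for all $Y\in\mathcal H_m$, $$\frac{\langle D_X\Phi(Z+\epsilon Y)-D_X\Phi(Z),Y\rangle}{\epsilon}\to\langle D_X^2\Phi(Z)(Y),Y\rangle\qquad(\epsilon\to0).$$ **Proposition.** Let $F:\mathcal P_2\to\mathbb R$ be continuous, with a functional derivative and a second-order functional derivative as above. Assume that the derivatives $D\frac{dF}{d\nu}(m)(x)$, $D^2\frac{dF}{d\nu}(m)(x)$ and $DD_1\frac{d^2F}{d\nu^2}(m)(x,x^1)$ exist and are jointly continuous in all their arguments, and that for some constant $C$ and all $m,x,x_1,x_2,x^1$ $$|F(m)|\le C\Big(1+\int|x|^2dm(x)\Big),\quad\Big|\frac{dF}{d\nu}(m)(x)\Big|\le C(1+|x|^2),\quad\Big|D\frac{dF}{d\nu}(m)(x)\Big|\le C(1+|x|^2)^{1/2},$$ $$\Big|D\frac{dF}{d\nu}(m)(x_1)-D\frac{dF}{d\nu}(m)(x_2)\Big|\le C|x_1-x_2|,\quad\Big|D^2\frac{dF}{d\nu}(m)(x)\Big|\le C,\quad\Big|DD_1\frac{d^2F}{d\nu^2}(m)(x,x^1)\Big|\le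 C.$$ Then for every $Z\in\mathcal H_m$ the random variable $F((Z\otimes m)^{\mathcal B})$ is integrable, and the functional $\Phi(Z)=\mathbb E\,F((Z\otimes m)^{\mathcal B})$ has at every $Z\in\mathcal H_m$ a second-order Gâteaux derivative, given for all $Y\in\mathcal H_m$, $\mathbb P\otimes m$-almost everywhere, by $$\big(D_X^2\Phi(Z)(Y)\big)_x=D^2\frac{dF}{d\nu}\big((Z\otimes m)^{\mathcal B}\big)(Z_x)\,Y_x+\mathbb E^{1\mathcal B}\Big(\int DD_1\frac{d^2F}{d\nu^2}\big((Z\otimes m)^{\mathcal B}\big)(Z_x,Z^1_{x^1})\,Y^1_{x^1}\,dm(x^1)\Big).$$ Here $(Z^1,Y^1)$ is a copy of $(Z,Y)$, independent of $(Z,Y)$ conditionally on $\mathcal B$, and $\mathbb E^{1\mathcal B}$ averages over the copy only: for fixed $\omega$ and $x$, $\mathbb E^{1\mathcal B}\int\psi(Z_x,Z^1_{x^1},Y^1_{x^1})\,dm(x^1)$ is the integral of $(z,y)\mapsto\psi(Z_x(\omega),z,y)$ against the conditional law $((Z,Y)\otimes m)^{\mathcal B}(\omega)$ of $(Z_{x^1},Y_{x^1})$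 under $\mathbb P\otimes m$ given $\mathcal B$; the integrand is integrable for almost every $(\omega,x)$. If moreover $\frac{d^2F}{d\nu^2}(m)(x,x^1)$ is symmetric in $(x,x^1)$ for every $m$, the operators $D_X^2\Phi(Z)$ given by this formula are self-adjoint. -/

import Mathlib

open MeasureTheory ProbabilityTheory Set Filter Topology
open scoped ENNReal

noncomputable section

/-- The space `ℝⁿ` with its Euclidean norm. -/
abbrev Rn (n : ℕ) : Type := EuclideanSpace ℝ (Fin n)

/-! ### The Wasserstein space -/

/-- `𝒫₂(ℝⁿ)`: the Borel probability measures on `ℝⁿ` with finite second moment. -/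
structure P2 (n : ℕ) : Type where
  toMeasure : Measure (Rn n)
  isProb : IsProbabilityMeasure toMeasure
  memLp_id : MemLp id 2 toMeasure

namespace P2

variable {n : ℕ}

instance : CoeOut (P2 n) (Measure (Rn n)) := ⟨P2.toMeasure⟩

instance (μ : P2 n) : IsProbabilityMeasure (μ : Measure (Rn n)) := μ.isProb

/-- The couplings of `μ` and `ν`: the joint laws of pairs `(X, X')` with `X ∼ μ` and `X' ∼ ν`. -/
def couplings (μ ν : P2 n) : Set (Measure (Rn n × Rn n)) :=
  {π | π.map Prod.fst = (μ : Measure (Rn n)) ∧ π.map Prod.snd = (ν : Measure (Rn n))}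

/-- The Wasserstein distance `W₂`: `W₂(μ,ν)²` is the infimum of `𝔼|X - X'|²` over all couplings. -/
def W2 (μ ν : P2 n) : ℝ≥0∞ :=
  (⨅ π ∈ couplings μ ν, ∫⁻ q, ‖q.1 - q.2‖ₑ ^ 2 ∂π) ^ ((1 : ℝ) / 2)

/-- The topology of the metric `W₂`: a set is open when it contains a `W₂`-ball around each of its
points. Continuity of functions of `m ∈ 𝒫₂(ℝⁿ)`, and joint continuity in `(m,x)` and
`(m,x,x¹)`, refer to it. -/
instance : TopologicalSpace (P2 n) where
  IsOpen U := ∀ μ ∈ U, ∃ r : ℝ≥0∞, 0 < r ∧ ∀ ν, W2 μ ν < r → ν ∈ U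
  isOpen_univ := fun _ _ => ⟨1, one_pos, fun _ _ => mem_univ _⟩
  isOpen_inter := by
    rintro U V hU hV μ ⟨hμU, hμV⟩
    obtain ⟨r, hr, hrU⟩ := hU μ hμU
    obtain ⟨s, hs, hsV⟩ := hV μ hμV
    exact ⟨min r s, lt_min hr hs, fun ν hν =>
      ⟨hrU ν (hν.trans_le (min_le_left _ _)), hsV ν (hν.trans_le (min_le_right _ _))⟩⟩
  isOpen_sUnion := by
    rintro S hS μ ⟨U, hUS, hμU⟩
    obtain ⟨r, hr, hrU⟩ := hS U hUS μ hμU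
    exact ⟨r, hr, fun ν hν => ⟨U, hUS, hrU ν hν⟩⟩

/-- The Dirac mass at the origin. -/
def diracZero (n : ℕ) : P2 n where
  toMeasure := Measure.dirac 0
  isProb := inferInstance
  memLp_id := by
    refine (memLp_congr_ae (g := fun _ => (0 : Rn n)) ?_).2 (memLp_const 0)
    exact (ae_dirac_iff (measurableSet_eq_fun measurable_id measurable_const)).2 rfl

/-- The convex combination `μ + t (ν - μ) = (1 - t) μ + t ν`, for `t ∈ [0,1]`. -/
def mix (μ ν : P2 n) (t : unitInterval) : P2 n where
  toMeasure := ENNReal.ofReal (1 - t) • (μ : Measure (Rn n)) +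
    ENNReal.ofReal t • (ν : Measure (Rn n))
  isProb := ⟨by
    simp only [Measure.coe_add, Measure.coe_smul, Pi.add_apply, Pi.smul_apply, measure_univ,
      smul_eq_mul, mul_one]
    rw [← ENNReal.ofReal_add (sub_nonneg.2 t.2.2) t.2.1]
    simp⟩
  memLp_id := by
    have h₁ := μ.memLp_id.smul_measure (c := ENNReal.ofReal (1 - t)) ENNReal.ofReal_ne_top
    have h₂ := ν.memLp_id.smul_measure (c := ENNReal.ofReal t) ENNReal.ofReal_ne_top
    rw [memLp_two_iff_integrable_sq_norm (by fun_prop)] at h₁ h₂ ⊢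
    exact h₁.add_measure h₂

/-- The segment `θ ↦ μ + θ (ν - μ)` with a real parameter; it is used for `θ ∈ [0,1]` only. -/
def segment (μ ν : P2 n) (θ : ℝ) : P2 n := mix μ ν (projIcc 0 1 zero_le_one θ)

/-- `∫ f(x) d(ν - μ)(x)`. -/
def intDiff (f : Rn n → ℝ) (μ ν : P2 n) : ℝ :=
  ∫ x, f x ∂(ν : Measure (Rn n)) - ∫ x, f x ∂(μ : Measure (Rn n))

/-- `∫∫ f(x,x¹) d(ν - μ)(x) d(ν - μ)(x¹)`. -/
def intDiff₂ (f : Rn n → Rn n → ℝ) (μ ν : P2 n) : ℝ :=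
  intDiff (fun x => intDiff (fun x₁ => f x x₁) μ ν) μ ν

end P2

/-! ### Functional derivatives -/

/-- `dF` is a (first-order) functional derivative `(m,x) ↦ dF/dν(m)(x)` of `F : 𝒫₂(ℝⁿ) → ℝ`: it is
jointly continuous, its integrals against measures of `𝒫₂(ℝⁿ)` exist, and
`(F(m + ε(m' - m)) - F(m)) / ε → ∫ dF/dν(m)(x) d(m' - m)(x)` as `ε → 0`, where `ε > 0` because
`m + ε(m' - m)` has to be a probability measure. -/
structure IsFunctionalDerivative {n : ℕ} (F : P2 n → ℝ) (dF : P2 n → Rn n → ℝ) : Prop where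
  continuous : Continuous fun p : P2 n × Rn n => dF p.1 p.2
  integrable : ∀ m m' : P2 n, Integrable (dF m) (m' : Measure (Rn n))
  tendsto : ∀ m m' : P2 n,
    Tendsto (fun ε : ℝ => (F (P2.segment m m' ε) - F m) / ε) (𝓝[>] 0)
      (𝓝 (P2.intDiff (dF m) m m'))

/-- `d2F` is a second-order functional derivative `(m,x,x¹) ↦ d²F/dν²(m)(x,x¹)` of `F`: it is
jointly continuous, its double integrals exist, and `θ ↦ F(m + θ(m' - m))` is twice continuously
differentiable on `[0,1]` with second derivative
`∫∫ d²F/dν²(m + θ(m' - m))(x,x¹) d(m' - m)(x) d(m' - m)(x¹)`. -/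
structure IsSecondFunctionalDerivative {n : ℕ} (F : P2 n → ℝ) (d2F : P2 n → Rn n → Rn n → ℝ) :
    Prop where
  continuous : Continuous fun p : P2 n × Rn n × Rn n => d2F p.1 p.2.1 p.2.2
  integrable : ∀ m μ ν : P2 n, Integrable (fun q : Rn n × Rn n => d2F m q.1 q.2)
    ((μ : Measure (Rn n)).prod (ν : Measure (Rn n)))
  hasDeriv : ∀ m m' : P2 n, ∃ g : ℝ → ℝ,
    (∀ θ ∈ Icc (0 : ℝ) 1,
      HasDerivWithinAt (fun t => F (P2.segment m m' t)) (g θ) (Icc 0 1) θ) ∧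
    (∀ θ ∈ Icc (0 : ℝ) 1,
      HasDerivWithinAt g (P2.intDiff₂ (d2F (P2.segment m m' θ)) m m') (Icc 0 1) θ) ∧
    ContinuousOn (fun θ => P2.intDiff₂ (d2F (P2.segment m m' θ)) m m') (Icc 0 1)

/-- `K x x¹` is the matrix `D D₁ f(x,x¹)` of mixed second derivatives `∂²f/∂xᵢ∂x¹ⱼ`, acting on
vectors in the `x¹` direction: `f` has a gradient `D₁ f` in its second argument, and for every `v`
the function `x ↦ D₁ f(x,x¹) · v` has the gradient `K x x¹ v`. -/
def IsMixedHessian {n : ℕ} (f : Rn n → Rn n → ℝ) (K : Rn n → Rn n → Rn n →L[ℝ] Rn n) : Prop :=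
  ∃ D₁f : Rn n → Rn n → Rn n,
    (∀ x x₁, HasGradientAt (f x) (D₁f x x₁) x₁) ∧
    ∀ x x₁ v, HasGradientAt (fun y => inner ℝ (D₁f y x₁) v) (K x x₁ v) x

/-! ### Gâteaux derivatives in a Hilbert space -/

/-- `g` is the Gâteaux derivative (gradient) of `Φ` at `Z`. -/
def HasGateauxGradientAt {H : Type*} [NormedAddCommGroup H] [InnerProductSpace ℝ H]
    (Φ : H → ℝ) (g Z : H) : Prop :=
  ∀ Y : H, Tendsto (fun ε : ℝ => (Φ (Z + ε • Y) - Φ Z) / ε) (𝓝[≠] 0) (𝓝 (inner ℝ g Y))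

/-- The bounded operator `A` is a second-order Gâteaux derivative of `Φ` at `Z`: `Φ` has a Gâteaux
derivative `G` everywhere and `⟨G(Z + εY) - G(Z), Y⟩ / ε → ⟨A Y, Y⟩` as `ε → 0`, for all `Y`. -/
def HasSecondGateauxDerivAt {H : Type*} [NormedAddCommGroup H] [InnerProductSpace ℝ H]
    (Φ : H → ℝ) (A : H →L[ℝ] H) (Z : H) : Prop :=
  ∃ G : H → H, (∀ Z' : H, HasGateauxGradientAt Φ (G Z') Z') ∧
    ∀ Y : H, Tendsto (fun ε : ℝ => inner ℝ (G (Z + ε • Y) - G Z) Y / ε) (𝓝[≠] 0)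
      (𝓝 (inner ℝ (A Y) Y))

/-! ### Random fields and conditional laws -/

/-- The Hilbert space `ℋ_m = L²(Ω, 𝒜, ℙ; L²_m(ℝⁿ; ℝⁿ))`, as the space of (classes of) random fields
`(ω,x) ↦ Z_x(ω)` that are square integrable for `ℙ ⊗ m`. -/
abbrev Hm {n : ℕ} {Ω : Type*} [MeasurableSpace Ω] (P : Measure Ω) (m : P2 n) : Type _ :=
  Lp (Rn n) 2 (P.prod (m : Measure (Rn n)))

section Conditional

variable {n : ℕ} {Ω : Type*} (B : MeasurableSpace Ω) [mΩ : MeasurableSpace Ω]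
  (P : Measure Ω) [IsProbabilityMeasure P] (m : P2 n)

/-- The conditional law `(U ⊗ m)^ℬ` of a random field `(ω,x) ↦ U_x(ω)` given the sub-`σ`-algebra
`ℬ`: the `ℬ`-measurable random probability measure with
`∫ φ d(U ⊗ m)^ℬ = 𝔼^ℬ (∫ φ(U_x) dm(x))`. It is the regular conditional distribution, under
`ℙ ⊗ m`, of `(ω,x) ↦ U_x(ω)` given `(ω,x) ↦ ω ∈ (Ω, ℬ)`. -/
def condFieldLaw {V : Type*} [MeasurableSpace V] [StandardBorelSpace V] [Nonempty V]
    (U : Ω × Rn n → V) : @Kernel Ω V B _ :=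
  @condDistrib (Ω × Rn n) Ω V _ _ _ _ B U Prod.fst (P.prod (m : Measure (Rn n))) _

open Classical in
/-- `(Z ⊗ m)^ℬ` as a random element of `𝒫₂(ℝⁿ)`, for `Z ∈ ℋ_m`; the second moment is finite for
almost every `ω`, and on the exceptional null set the value is a fixed element of `𝒫₂(ℝⁿ)`. -/
def condLaw (Z : Hm P m) (ω : Ω) : P2 n :=
  if h : MemLp id 2 (condFieldLaw B P m Z ω) then
    { toMeasure := condFieldLaw B P m Z ω
      isProb := by unfold condFieldLaw; infer_instance
      memLp_id := h }
  else P2.diracZero n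

/-- The functional `Z ↦ 𝔼 F((Z ⊗ m)^ℬ)` on `ℋ_m`. -/
def condFunctional (F : P2 n → ℝ) (Z : Hm P m) : ℝ :=
  ∫ ω, F (condLaw B P m Z ω) ∂P

/-- The conditional law given `ℬ` of the pair of fields `(Z_{x¹}, Y_{x¹})`, with `x¹` drawn from
`m`. Integrating `φ(Z_x(ω), z, y)` in `(z, y)` against it, with `(ω,x)` fixed, is
`𝔼^{1ℬ} ∫ φ(Z_x, Z¹_{x¹}, Y¹_{x¹}) dm(x¹)`, where `(Z¹, Y¹)` is a copy of `(Z, Y)` that is independent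
of it conditionally on `ℬ`, and `𝔼^{1ℬ}` averages over the copy only. -/
def condCopyLaw (Z Y : Hm P m) : @Kernel Ω (Rn n × Rn n) B _ :=
  condFieldLaw B P m fun p => (Z p, Y p)

end Conditional

end

/-! Conditioning on ℬ is removed one ω at a time. Let κ(ω) be the conditional law of (Z,Y) given ℬ.
For each ε and almost every ω, the conditional law of Z + εY is the image of κ(ω) under (z,y) ↦ z +
εy (`conditionalLaw_comp_ae`). So it suffices to study h ↦ F(law(X + hY)) for square integrable X, Y
on one probability space, with bounds by multiples of 𝔼|Y|², which can be averaged over ω.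

There, F is expanded between law X and law X' along the segment of measures joining them. The second
derivative on the segment is an integral, over two independent copies, of a mixed second difference
of d²F/dν²; by the mean value theorem this difference is a value of DD₁ d²F/dν² applied to the two
increments. A Taylor expansion of dF/dν(law X) in space gives the other quadratic term. The
remainder is therefore at most C 𝔼|X' - X|² (`norm_remainder_le`), which yields the Gâteaux gradient
D dF/dν((Z⊗m)^ℬ)(Z_x); along X + hY it converges after division by h² (`tendsto_remainder`).

Nothing is assumed about differentiability of D dF/dν(m)(x) in m. The expansion from X to X + hY is
added to the one from X + hY back to X: the values of F cancel, and h times the increment of the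
first variation is left (`firstVariation_sub`). Each remainder contributes half of the second
variation. Dominated convergence in ω then gives the quadratic form of the second derivative.

To compose W₂-continuous functions with random measures, the latter must be strongly measurable for
W₂; this is `stronglyMeasurable_of_measurable`. -/

/-! ### Laws of square integrable vectors, W₂-convergence and measurability in 𝒫₂. -/

namespace P2

variable {n : ℕ}

theorem ext_toMeasure {μ ν : P2 n} (h : μ.toMeasure = ν.toMeasure) : μ = ν := by
  cases μ; cases ν; cases h; rfl

/-- The law of a square integrable random vector. -/
noncomputable def law {T : Type*} [MeasurableSpace T] (π : Measure T) [IsProbabilityMeasure π] (X : T → Rn n)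
    (hX : MemLp X 2 π) : P2 n where
  toMeasure := π.map X
  isProb := Measure.isProbabilityMeasure_map hX.1.aemeasurable
  memLp_id := (memLp_map_measure_iff aestronglyMeasurable_id hX.1.aemeasurable).2 hX

/-- Immediate from the definition of open sets; neither the triangle inequality for W₂ nor openness
of balls is needed. -/
theorem tendsto_of_W2 {ι : Type*} {l : Filter ι} {ν : ι → P2 n} {μ : P2 n}
    (h : Tendsto (fun i => W2 μ (ν i)) l (𝓝 0)) : Tendsto ν l (𝓝 μ) := by
  intro U hU
  obtain ⟨V, hVU, hV, hμ⟩ := mem_nhds_iff.1 hU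
  obtain ⟨r, hr, hrV⟩ := hV μ hμ
  filter_upwards [h.eventually_lt_const hr] with i hi using hVU (hrV _ hi)

theorem W2_le {μ ν : P2 n} {π : Measure (Rn n × Rn n)} (hπ : π ∈ couplings μ ν) :
    W2 μ ν ≤ (∫⁻ q, ‖q.1 - q.2‖ₑ ^ 2 ∂π) ^ ((1 : ℝ) / 2) :=
  ENNReal.rpow_le_rpow (iInf₂_le π hπ) (by norm_num)

theorem lintegral_enorm_sq_eq {T : Type*} [MeasurableSpace T] {π : Measure T} {f : T → Rn n} :
    ∫⁻ t, ‖f t‖ₑ ^ 2 ∂π = eLpNorm f 2 π ^ 2 := by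
  have := eLpNorm_nnreal_pow_eq_lintegral (f := f) (μ := π) (p := 2) (by norm_num)
  simpa using this.symm

section Law

variable {T : Type*} [MeasurableSpace T] {π : Measure T} [IsProbabilityMeasure π]

/-- The bound is uniform in `t`, so it controls the intermediate measures produced by a mean value
theorem, about whose position nothing is known. -/
theorem W2_law_mix_le {W X X' : T → Rn n} (hW : MemLp W 2 π) (hX : MemLp X 2 π)
    (hX' : MemLp X' 2 π) (t : unitInterval) :
    W2 (law π W hW) (mix (law π X hX) (law π X' hX') t) ≤
      eLpNorm (X - W) 2 π + eLpNorm (X' - W) 2 π := by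
  have mW := hW.1.aemeasurable
  have mX := hX.1.aemeasurable
  have mX' := hX'.1.aemeasurable
  have hint : ∀ {V : T → Rn n}, AEMeasurable V π →
      ∫⁻ q, ‖q.1 - q.2‖ₑ ^ 2 ∂(π.map fun t => (W t, V t)) = eLpNorm (V - W) 2 π ^ 2 := by
    intro V mV
    rw [lintegral_map' (by fun_prop) (mW.prodMk mV), ← lintegral_enorm_sq_eq]
    refine lintegral_congr fun t => ?_
    rw [Pi.sub_apply, ← enorm_neg, neg_sub]
  -- The coupling is the mixture, with the same weights, of the joint laws of (W,X) and (W,X').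
  have hc : ENNReal.ofReal (1 - t) • π.map (fun t => (W t, X t)) +
      ENNReal.ofReal t • π.map (fun t => (W t, X' t)) ∈
      couplings (law π W hW) (mix (law π X hX) (law π X' hX') t) := by
    constructor
    · rw [Measure.map_add _ _ measurable_fst, Measure.map_smul, Measure.map_smul,
        AEMeasurable.map_map_of_aemeasurable (by fun_prop) (mW.prodMk mX),
        AEMeasurable.map_map_of_aemeasurable (by fun_prop) (mW.prodMk mX')]
      change _ • π.map W + _ • π.map W = π.map W
      rw [← add_smul, ← ENNReal.ofReal_add (sub_nonneg.2 t.2.2) t.2.1]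
      simp
    · rw [Measure.map_add _ _ measurable_snd, Measure.map_smul, Measure.map_smul,
        AEMeasurable.map_map_of_aemeasurable (by fun_prop) (mW.prodMk mX),
        AEMeasurable.map_map_of_aemeasurable (by fun_prop) (mW.prodMk mX')]
      rfl
  refine (W2_le hc).trans ?_
  rw [lintegral_add_measure, lintegral_smul_measure, lintegral_smul_measure, hint mX, hint mX']
  simp only [smul_eq_mul, one_div]
  rw [ENNReal.rpow_inv_le_iff (by norm_num), ENNReal.rpow_two]
  set a := eLpNorm (X - W) 2 π
  set b := eLpNorm (X' - W) 2 π
  have h1 : ENNReal.ofReal (1 - t) ≤ 1 := by simpa using t.2.1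
  have h2 : ENNReal.ofReal t ≤ 1 := by simpa using t.2.2
  calc ENNReal.ofReal (1 - t) * a ^ 2 + ENNReal.ofReal t * b ^ 2
      ≤ ENNReal.ofReal (1 - t) * (a + b) ^ 2 + ENNReal.ofReal t * (a + b) ^ 2 := by
        gcongr <;> simp
    _ = (a + b) ^ 2 := by
        rw [← add_mul, ← ENNReal.ofReal_add (sub_nonneg.2 t.2.2) t.2.1]
        simp

theorem mix_zero (μ ν : P2 n) : mix μ ν 0 = μ := by
  apply ext_toMeasure
  simp [mix]

theorem mix_one (μ ν : P2 n) : mix μ ν 1 = ν := by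
  apply ext_toMeasure
  simp [mix]

theorem tendsto_mix_law {ι : Type*} {l : Filter ι} {W : T → Rn n} {X X' : ι → T → Rn n}
    (hW : MemLp W 2 π) (hX : ∀ i, MemLp (X i) 2 π) (hX' : ∀ i, MemLp (X' i) 2 π)
    (t : ι → unitInterval) (h : Tendsto (fun i => eLpNorm (X i - W) 2 π) l (𝓝 0))
    (h' : Tendsto (fun i => eLpNorm (X' i - W) 2 π) l (𝓝 0)) :
    Tendsto (fun i => mix (law π (X i) (hX i)) (law π (X' i) (hX' i)) (t i)) l
      (𝓝 (law π W hW)) := by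
  refine tendsto_of_W2 (tendsto_of_tendsto_of_tendsto_of_le_of_le tendsto_const_nhds
    (by simpa using h.add h') (fun _ => zero_le) fun i => W2_law_mix_le _ _ _ _)

theorem tendsto_law {ι : Type*} {l : Filter ι} {W : T → Rn n} {X : ι → T → Rn n}
    (hW : MemLp W 2 π) (hX : ∀ i, MemLp (X i) 2 π)
    (h : Tendsto (fun i => eLpNorm (X i - W) 2 π) l (𝓝 0)) :
    Tendsto (fun i => law π (X i) (hX i)) l (𝓝 (law π W hW)) := by
  simpa [mix_zero] using tendsto_mix_law hW hX hX (fun _ => 0) h h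

theorem continuous_law :
    Continuous fun X : Lp (Rn n) 2 π => law π X (Lp.memLp X) := by
  refine continuous_iff_continuousAt.2 fun X => tendsto_law _ _ ?_
  have : Tendsto (fun Y : Lp (Rn n) 2 π => edist Y X) (𝓝 X) (𝓝 0) := by
    simpa using (tendsto_id (α := Lp (Rn n) 2 π) (x := 𝓝 X)).edist (tendsto_const_nhds (x := X))
  exact this.congr fun Y => Lp.edist_def Y X

end Law

/-- A family of elements of an `L²` space that is jointly measurable is strongly measurable. -/
theorem stronglyMeasurable_toLp {X T : Type*} [MeasurableSpace X] [MeasurableSpace T]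
    [MeasurableSpace.CountablyGenerated T]
    {π : Measure T} [IsProbabilityMeasure π] {f : X → T → Rn n}
    (hf : Measurable (Function.uncurry f)) (hL : ∀ x, MemLp (f x) 2 π) :
    StronglyMeasurable fun x => (hL x).toLp (f x) := by
  have : Fact ((2 : ℝ≥0∞) ≠ ∞) := ⟨by norm_num⟩
  have : Fact ((1 : ℝ≥0∞) ≤ 2) := ⟨by norm_num⟩
  have : SecondCountableTopology (Lp (Rn n) 2 π) := inferInstance
  borelize ↥(Lp (Rn n) 2 π)
  refine Measurable.stronglyMeasurable ?_
  -- The squared distance to a fixed `g` is an integral depending measurably on the parameter, by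
  -- Tonelli.
  have hball : ∀ (g : Lp (Rn n) 2 π) (r : ℝ≥0∞),
      MeasurableSet ((fun x => (hL x).toLp (f x)) ⁻¹' Metric.eball g r) := by
    intro g r
    have hset : (fun x => (hL x).toLp (f x)) ⁻¹' Metric.eball g r =
        {x | ∫⁻ t, ‖f x t - g t‖ₑ ^ 2 ∂π < r ^ 2} := by
      ext x
      have : edist ((hL x).toLp (f x)) g = eLpNorm (f x - ⇑g) 2 π := by
        rw [Lp.edist_def]
        exact eLpNorm_congr_ae ((hL x).coeFn_toLp.sub (ae_eq_refl _))
      have h2 := lintegral_enorm_sq_eq (π := π) (f := f x - ⇑g)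
      simp only [Pi.sub_apply] at h2
      simp only [mem_preimage, Metric.mem_eball, this, mem_ofPred_eq, h2]
      exact ((ENNReal.pow_right_strictMono two_ne_zero).lt_iff_lt).symm
    rw [hset]
    refine measurableSet_lt (Measurable.lintegral_prod_right' (f := fun p : X × T =>
      ‖f p.1 p.2 - g p.2‖ₑ ^ 2) ?_) measurable_const
    have hg := (Lp.stronglyMeasurable g).measurable
    exact ((hf.sub (hg.comp measurable_snd)).enorm.pow_const 2)
  refine measurable_of_isOpen fun U hU => ?_
  -- Lindelöf: L² is separable here, so an open set is a countable union of the balls it contains.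
  obtain ⟨s, hs, hsU⟩ := TopologicalSpace.isOpen_iUnion_countable
    (fun q : {q : Lp (Rn n) 2 π × ℝ≥0∞ // Metric.eball q.1 q.2 ⊆ U} => Metric.eball q.1.1 q.1.2)
    (fun q => Metric.isOpen_eball)
  have hUeq : U = ⋃ q ∈ s, Metric.eball q.1.1 q.1.2 := by
    rw [hsU]
    refine Subset.antisymm (fun x hx => ?_) (iUnion_subset fun q => q.2)
    obtain ⟨r, hr, hrU⟩ := EMetric.isOpen_iff.1 hU x hx
    exact mem_iUnion.2 ⟨⟨(x, r), hrU⟩, Metric.mem_eball_self hr⟩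
  rw [hUeq, preimage_iUnion₂]
  exact MeasurableSet.biUnion hs fun q _ => hball _ _

/-- A kernel can be realised as the laws of jointly measurable variables f(x,·) on [0,1]. The map x
↦ f(x,·) into the separable space L²([0,1]) is strongly measurable, and taking laws is continuous
from L² to 𝒫₂. This avoids studying separability of W₂ itself. -/
theorem stronglyMeasurable_of_measurable {X : Type*} [MeasurableSpace X] {κ : X → P2 n}
    (hκ : Measurable fun x => (κ x).toMeasure) : StronglyMeasurable κ := by
  let K : Kernel X (Rn n) := ⟨fun x => (κ x).toMeasure, hκ⟩
  have : IsMarkovKernel K := ⟨fun x => (κ x).isProb⟩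
  obtain ⟨f, hf, hfK⟩ := Kernel.exists_measurable_map_eq_unitInterval K
  have hL : ∀ x, MemLp (f x) 2 (volume : Measure unitInterval) := fun x => by
    have hm : Measurable (f x) := hf.of_uncurry_left
    have := (κ x).memLp_id
    rw [show (κ x).toMeasure = (volume : Measure unitInterval).map (f x) from (hfK x).symm] at this
    exact (memLp_map_measure_iff aestronglyMeasurable_id hm.aemeasurable).1 this
  have := continuous_law.comp_stronglyMeasurable (stronglyMeasurable_toLp hf hL)
  convert this using 1
  funext x
  apply ext_toMeasure
  change _ = (volume : Measure unitInterval).map _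
  rw [Measure.map_congr (hL x).coeFn_toLp]
  exact (hfK x).symm

end P2

/-! ### Taylor's formula and mixed second differences. -/

/-- Taylor's formula of order two on `[0,1]` with the Lagrange form of the remainder, for a twice
differentiable function. -/
theorem exists_taylor_lagrange_two {φ g q : ℝ → ℝ}
    (h₁ : ∀ θ ∈ Icc (0 : ℝ) 1, HasDerivWithinAt φ (g θ) (Icc 0 1) θ)
    (h₂ : ∀ θ ∈ Icc (0 : ℝ) 1, HasDerivWithinAt g (q θ) (Icc 0 1) θ) :
    ∃ c ∈ Ioo (0 : ℝ) 1, φ 1 - φ 0 - g 0 = q c / 2 := by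
  have hψ : ∀ θ ∈ Icc (0 : ℝ) 1, HasDerivWithinAt (fun t => φ 1 - φ t - (1 - t) * g t)
      (-(1 - θ) * q θ) (Icc 0 1) θ := fun θ hθ => by
    have := ((h₁ θ hθ).const_sub (φ 1)).sub
      (((hasDerivWithinAt_id θ (Icc (0 : ℝ) 1)).const_sub 1).mul (h₂ θ hθ))
    refine this.congr_deriv ?_
    change -g θ - (-1 * g θ + (1 - θ) * q θ) = _
    ring
  have hχ : ∀ θ : ℝ, HasDerivAt (fun t : ℝ => (1 - t) ^ 2) (-2 * (1 - θ)) θ := fun θ => by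
    have := ((hasDerivAt_id θ).const_sub 1).pow 2
    refine this.congr_deriv ?_
    simp
  -- Cauchy's mean value theorem, with (1 - t)² as the comparison function; continuity of `q` is not
  -- required.
  obtain ⟨c, hc, h⟩ := exists_ratio_hasDerivAt_eq_ratio_slope
    (fun t => φ 1 - φ t - (1 - t) * g t) (fun θ => -(1 - θ) * q θ) zero_lt_one
    (fun θ hθ => (hψ θ hθ).continuousWithinAt)
    (fun θ hθ => (hψ θ (Ioo_subset_Icc_self hθ)).hasDerivAt (Icc_mem_nhds hθ.1 hθ.2))
    (fun t : ℝ => (1 - t) ^ 2) (fun θ => -2 * (1 - θ))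
    (fun θ _ => (hχ θ).continuousAt.continuousWithinAt) (fun θ _ => hχ θ)
  refine ⟨c, hc, ?_⟩
  have hc1 : (1 - c) ≠ 0 := (sub_pos.2 hc.2).ne'
  apply mul_left_cancel₀ hc1
  linear_combination -h / 2

/-- The mixed second difference of `f`. -/
def mixedDiff {E : Type*} (f : E → E → ℝ) (a b a' b' : E) : ℝ :=
  f b b' - f b a' - (f a b' - f a a')

theorem IsMixedHessian.exists_mixedDiff_eq {n : ℕ} {f : Rn n → Rn n → ℝ}
    {K : Rn n → Rn n → Rn n →L[ℝ] Rn n} (h : IsMixedHessian f K) (a b a' b' : Rn n) :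
    ∃ s ∈ Ioo (0 : ℝ) 1, ∃ t ∈ Ioo (0 : ℝ) 1, mixedDiff f a b a' b' =
      inner ℝ (K (a + s • (b - a)) (a' + t • (b' - a')) (b' - a')) (b - a) := by
  obtain ⟨D, h₁, h₂⟩ := h
  have hline : ∀ (x v : Rn n) (t : ℝ), HasDerivAt (fun t : ℝ => x + t • v) v t := fun x v t => by
    simpa using ((hasDerivAt_id t).smul_const v).const_add x
  have hu : ∀ t : ℝ, HasDerivAt (fun t : ℝ => f b (a' + t • (b' - a')) - f a (a' + t • (b' - a')))
      (inner ℝ (D b (a' + t • (b' - a'))) (b' - a') -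
        inner ℝ (D a (a' + t • (b' - a'))) (b' - a')) t := fun t => by
    have e := fun x => (h₁ x (a' + t • (b' - a'))).hasFDerivAt.comp_hasDerivAt t
      (hline a' (b' - a') t)
    exact ((e b).sub (e a)).congr_deriv (by simp)
  -- The mean value theorem is used in the second argument first, on f(b,·) - f(a,·). With `t` then
  -- fixed, it is used in the first argument, matching the order of differentiation in
  -- `IsMixedHessian`.
  obtain ⟨t, ht, het⟩ := exists_hasDerivAt_eq_slope _ _ zero_lt_one
    (fun t _ => (hu t).continuousAt.continuousWithinAt) (fun t _ => hu t)
  have hv : ∀ s : ℝ, HasDerivAt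
      (fun s : ℝ => inner ℝ (D (a + s • (b - a)) (a' + t • (b' - a'))) (b' - a'))
      (inner ℝ (K (a + s • (b - a)) (a' + t • (b' - a')) (b' - a')) (b - a)) s := fun s => by
    have e := (h₂ (a + s • (b - a)) (a' + t • (b' - a')) (b' - a')).hasFDerivAt.comp_hasDerivAt s
      (hline a (b - a) s)
    exact e.congr_deriv InnerProductSpace.toDual_apply_apply
  obtain ⟨s, hs, hes⟩ := exists_hasDerivAt_eq_slope _ _ zero_lt_one
    (fun t _ => (hv t).continuousAt.continuousWithinAt) (fun t _ => hv t)
  refine ⟨s, hs, t, ht, ?_⟩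
  simp only [one_smul, zero_smul, add_zero, add_sub_cancel, sub_zero, div_one] at het hes
  rw [hes, het]
  unfold mixedDiff
  ring

/-! ### Expansion of F between the laws of two random vectors. -/

/-- The hypotheses on a functional of measures under which its lift to random fields is twice
differentiable. -/
structure IsRegularFunctional {n : ℕ} (F : P2 n → ℝ) (C : ℝ) (dF : P2 n → Rn n → ℝ)
    (DdF : P2 n → Rn n → Rn n) (D2dF : P2 n → Rn n → Rn n →L[ℝ] Rn n)
    (d2F : P2 n → Rn n → Rn n → ℝ) (K : P2 n → Rn n → Rn n → Rn n →L[ℝ] Rn n) : Prop where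
  cont : Continuous F
  growth : ∀ μ : P2 n, |F μ| ≤ C * (1 + ∫ x, ‖x‖ ^ 2 ∂(μ : Measure (Rn n)))
  first : IsFunctionalDerivative F dF
  grad : ∀ μ x, HasGradientAt (dF μ) (DdF μ x) x
  grad_cont : Continuous fun p : P2 n × Rn n => DdF p.1 p.2
  grad_growth : ∀ μ x, ‖DdF μ x‖ ≤ C * √(1 + ‖x‖ ^ 2)
  hess : ∀ μ x, HasFDerivAt (DdF μ) (D2dF μ x) x
  hess_cont : Continuous fun p : P2 n × Rn n => D2dF p.1 p.2
  hess_bdd : ∀ μ x, ‖D2dF μ x‖ ≤ C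
  second : IsSecondFunctionalDerivative F d2F
  mixed : ∀ μ, IsMixedHessian (d2F μ) (K μ)
  mixed_cont : Continuous fun p : P2 n × Rn n × Rn n => K p.1 p.2.1 p.2.2
  mixed_bdd : ∀ μ x x₁, ‖K μ x x₁‖ ≤ C

namespace P2

variable {n : ℕ}

theorem integrable_comp_of_law {T : Type*} [MeasurableSpace T] {π : Measure T}
    [IsProbabilityMeasure π] {X : T → Rn n} (hX : MemLp X 2 π) {f : Rn n → ℝ} (hf : Continuous f)
    (h : Integrable f (law π X hX).toMeasure) : Integrable (fun t => f (X t)) π :=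
  (integrable_map_measure hf.aestronglyMeasurable hX.1.aemeasurable).1 h

theorem integral_law {T : Type*} [MeasurableSpace T] {π : Measure T}
    [IsProbabilityMeasure π] {X : T → Rn n} (hX : MemLp X 2 π) {f : Rn n → ℝ}
    (hf : Continuous f) :
    ∫ x, f x ∂(law π X hX).toMeasure = ∫ t, f (X t) ∂π :=
  integral_map hX.1.aemeasurable hf.aestronglyMeasurable

theorem intDiff_law {T : Type*} [MeasurableSpace T] {π : Measure T}
    [IsProbabilityMeasure π] {X X' : T → Rn n} (hX : MemLp X 2 π) (hX' : MemLp X' 2 π)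
    {f : Rn n → ℝ} (hf : Continuous f) (h : ∀ μ : P2 n, Integrable f μ.toMeasure) :
    intDiff f (law π X hX) (law π X' hX') = ∫ t, (f (X' t) - f (X t)) ∂π := by
  rw [intDiff, integral_law hX hf, integral_law hX' hf, integral_sub
    (integrable_comp_of_law hX' hf (h _)) (integrable_comp_of_law hX hf (h _))]

theorem integral_integral_law {T : Type*} [MeasurableSpace T] {π : Measure T}
    [IsProbabilityMeasure π] {X X' : T → Rn n} (hX : MemLp X 2 π) (hX' : MemLp X' 2 π)
    {f : Rn n → Rn n → ℝ} (hf : Continuous (Function.uncurry f))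
    (h : ∀ μ ν : P2 n, Integrable (fun q : Rn n × Rn n => f q.1 q.2)
      (μ.toMeasure.prod ν.toMeasure)) :
    Integrable (fun p : T × T => f (X p.1) (X' p.2)) (π.prod π) ∧
    ∫ x, ∫ x', f x x' ∂(law π X' hX').toMeasure ∂(law π X hX).toMeasure =
      ∫ p : T × T, f (X p.1) (X' p.2) ∂(π.prod π) := by
  have hm : AEMeasurable (Prod.map X X') (π.prod π) :=
    (hX.1.comp_fst.aemeasurable).prodMk (hX'.1.comp_snd.aemeasurable)
  have hmap : (law π X hX).toMeasure.prod (law π X' hX').toMeasure =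
      (π.prod π).map (Prod.map X X') := by
    -- The product formula for image measures is applied to measurable representatives.
    have e : Prod.map X X' =ᵐ[π.prod π] Prod.map (hX.1.mk X) (hX'.1.mk X') := by
      filter_upwards [Measure.quasiMeasurePreserving_fst.ae_eq_comp hX.1.ae_eq_mk,
        Measure.quasiMeasurePreserving_snd.ae_eq_comp hX'.1.ae_eq_mk] with p h1 h2
      exact Prod.ext h1 h2
    rw [Measure.map_congr e, ← Measure.map_prod_map _ _ hX.1.stronglyMeasurable_mk.measurable
      hX'.1.stronglyMeasurable_mk.measurable, ← Measure.map_congr hX.1.ae_eq_mk,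
      ← Measure.map_congr hX'.1.ae_eq_mk]
    rfl
  have hi := h (law π X hX) (law π X' hX')
  refine ⟨?_, ?_⟩
  · rw [hmap] at hi
    exact (integrable_map_measure hf.aestronglyMeasurable hm).1 hi
  · rw [integral_integral hi, hmap]
    exact integral_map hm hf.aestronglyMeasurable

/-- All four terms of the product of signed measures are written on the same space T × T, so that
they cancel pointwise: the integrand becomes of the order of the product of the two increments. -/
theorem intDiff₂_law {T : Type*} [MeasurableSpace T] {π : Measure T}
    [IsProbabilityMeasure π] {X X' : T → Rn n} (hX : MemLp X 2 π) (hX' : MemLp X' 2 π)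
    {f : Rn n → Rn n → ℝ} (hf : Continuous (Function.uncurry f))
    (h : ∀ μ ν : P2 n, Integrable (fun q : Rn n × Rn n => f q.1 q.2)
      (μ.toMeasure.prod ν.toMeasure)) :
    intDiff₂ f (law π X hX) (law π X' hX') =
      ∫ p : T × T, mixedDiff f (X p.1) (X' p.1) (X p.2) (X' p.2) ∂(π.prod π) := by
  have I := fun μ ν : P2 n => (h μ ν).integral_prod_left
  have J := fun {U V : T → Rn n} (hU : MemLp U 2 π) (hV : MemLp V 2 π) =>
    integral_integral_law hU hV hf h
  unfold intDiff₂ intDiff mixedDiff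
  rw [integral_sub (I _ _) (I _ _), integral_sub (I _ _) (I _ _), (J hX' hX').2, (J hX' hX).2,
    (J hX hX').2, (J hX hX).2, ← integral_sub (J hX' hX').1 (J hX' hX).1,
    ← integral_sub (J hX hX').1 (J hX hX).1]
  exact (integral_sub ((J hX' hX').1.sub (J hX' hX).1) ((J hX hX').1.sub (J hX hX).1)).symm

end P2

namespace IsRegularFunctional

variable {n : ℕ} {F : P2 n → ℝ} {C : ℝ} {dF : P2 n → Rn n → ℝ}
  {DdF : P2 n → Rn n → Rn n} {D2dF : P2 n → Rn n → Rn n →L[ℝ] Rn n}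
  {d2F : P2 n → Rn n → Rn n → ℝ} {K : P2 n → Rn n → Rn n → Rn n →L[ℝ] Rn n}

theorem const_nonneg (R : IsRegularFunctional F C dF DdF D2dF d2F K) : 0 ≤ C :=
  (norm_nonneg _).trans (R.hess_bdd (P2.diracZero n) 0)

theorem exists_gradient_remainder (R : IsRegularFunctional F C dF DdF D2dF d2F K) (μ : P2 n)
    (a b : Rn n) : ∃ s ∈ Ioo (0 : ℝ) 1, dF μ b - dF μ a - inner ℝ (DdF μ a) (b - a) =
      inner ℝ (D2dF μ (a + s • (b - a)) (b - a)) (b - a) / 2 := by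
  have hline : ∀ t : ℝ, HasDerivAt (fun t : ℝ => a + t • (b - a)) (b - a) t := fun t => by
    simpa using ((hasDerivAt_id t).smul_const (b - a)).const_add a
  have h1 : ∀ t : ℝ, HasDerivAt (fun t : ℝ => dF μ (a + t • (b - a)))
      (inner ℝ (DdF μ (a + t • (b - a))) (b - a)) t := fun t => by
    exact ((R.grad μ (a + t • (b - a))).hasFDerivAt.comp_hasDerivAt t (hline t)).congr_deriv
      (by simp)
  have h2 : ∀ t : ℝ, HasDerivAt (fun t : ℝ => inner ℝ (DdF μ (a + t • (b - a))) (b - a))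
      (inner ℝ (D2dF μ (a + t • (b - a)) (b - a)) (b - a)) t := fun t => by
    have := (R.hess μ (a + t • (b - a))).comp_hasDerivAt t (hline t)
    exact (this.inner ℝ (hasDerivAt_const t (b - a))).congr_deriv (by simp)
  obtain ⟨s, hs, h⟩ := exists_taylor_lagrange_two (fun t _ => (h1 t).hasDerivWithinAt)
    (fun t _ => (h2 t).hasDerivWithinAt)
  exact ⟨s, hs, by simpa using h⟩

/-- Taylor–Lagrange for θ ↦ F(μ + θ(ν - μ)). The first derivative in `IsSecondFunctionalDerivative`
is an unspecified function. -/
theorem exists_segment_remainder (R : IsRegularFunctional F C dF DdF D2dF d2F K) (μ ν : P2 n) :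
    ∃ t : unitInterval, F ν - F μ - P2.intDiff (dF μ) μ ν =
      P2.intDiff₂ (d2F (P2.mix μ ν t)) μ ν / 2 := by
  obtain ⟨g, h1, h2, -⟩ := R.second.hasDeriv μ ν
  obtain ⟨c, hc, h⟩ := exists_taylor_lagrange_two h1 h2
  have h0 : P2.segment μ ν 0 = μ := by
    rw [P2.segment, projIcc_left]; exact P2.mix_zero μ ν
  have h1' : P2.segment μ ν 1 = ν := by
    rw [P2.segment, projIcc_right]; exact P2.mix_one μ ν
  -- Both sides are the limit of the same right difference quotient at 0.
  have hg : g 0 = P2.intDiff (dF μ) μ ν := by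
    have h2 : HasDerivWithinAt (fun t => F (P2.segment μ ν t)) (g 0) (Ioi 0) 0 :=
      (h1 0 ⟨le_rfl, zero_le_one⟩).mono_of_mem_nhdsWithin
        (mem_of_superset (Ioo_mem_nhdsGT zero_lt_one) Ioo_subset_Icc_self)
    have h3 := (hasDerivWithinAt_iff_tendsto_slope' (fun h => lt_irrefl _ h)).1 h2
    have h4 := R.first.tendsto μ ν
    simp only [slope_fun_def_field, h0, sub_zero] at h3
    have : (𝓝[>] (0 : ℝ)).NeBot := inferInstance
    exact tendsto_nhds_unique (l := 𝓝[>] (0 : ℝ)) h3 h4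
  rw [h0, h1', hg] at h
  exact ⟨_, h⟩

end IsRegularFunctional

theorem norm_mixedDiff_le {n : ℕ} {f : Rn n → Rn n → ℝ}
    {K : Rn n → Rn n → Rn n →L[ℝ] Rn n} (h : IsMixedHessian f K) {C : ℝ}
    (hK : ∀ x x', ‖K x x'‖ ≤ C) (a b a' b' : Rn n) :
    ‖mixedDiff f a b a' b'‖ ≤ C * (‖b - a‖ * ‖b' - a'‖) := by
  obtain ⟨s, -, t, -, e⟩ := h.exists_mixedDiff_eq a b a' b'
  rw [e]
  calc _ ≤ ‖K (a + s • (b - a)) (a' + t • (b' - a')) (b' - a')‖ * ‖b - a‖ := norm_inner_le_norm _ _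
    _ ≤ C * ‖b' - a'‖ * ‖b - a‖ := by
        gcongr
        exact (ContinuousLinearMap.le_opNorm _ _).trans (by gcongr; exact hK _ _)
    _ = _ := by ring

namespace IsRegularFunctional

variable {n : ℕ} {F : P2 n → ℝ} {C : ℝ} {dF : P2 n → Rn n → ℝ}
  {DdF : P2 n → Rn n → Rn n} {D2dF : P2 n → Rn n → Rn n →L[ℝ] Rn n}
  {d2F : P2 n → Rn n → Rn n → ℝ} {K : P2 n → Rn n → Rn n → Rn n →L[ℝ] Rn n}
  {T : Type*} [MeasurableSpace T] {π : Measure T} [IsProbabilityMeasure π]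

theorem continuous_dF (R : IsRegularFunctional F C dF DdF D2dF d2F K) (μ : P2 n) :
    Continuous (dF μ) :=
  R.first.continuous.comp (Continuous.prodMk_right μ)

theorem continuous_grad (R : IsRegularFunctional F C dF DdF D2dF d2F K) (μ : P2 n) :
    Continuous (DdF μ) :=
  R.grad_cont.comp (Continuous.prodMk_right μ)

theorem continuous_d2F (R : IsRegularFunctional F C dF DdF D2dF d2F K) (μ : P2 n) :
    Continuous (Function.uncurry (d2F μ)) :=
  R.second.continuous.comp (Continuous.prodMk_right μ)

theorem norm_grad_le (R : IsRegularFunctional F C dF DdF D2dF d2F K) (μ : P2 n) (x : Rn n) :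
    ‖DdF μ x‖ ≤ C * (1 + ‖x‖) := by
  refine (R.grad_growth μ x).trans (mul_le_mul_of_nonneg_left ?_ R.const_nonneg)
  rw [Real.sqrt_le_left (by positivity)]
  nlinarith [norm_nonneg x]

theorem memLp_grad (R : IsRegularFunctional F C dF DdF D2dF d2F K) {X : T → Rn n}
    (hX : MemLp X 2 π) {μ : T → P2 n}
    (hm : AEStronglyMeasurable (fun t => DdF (μ t) (X t)) π) :
    MemLp (fun t => DdF (μ t) (X t)) 2 π := by
  refine MemLp.mono' (((memLp_const (1 : ℝ)).add hX.norm).const_mul C) hm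
    (Eventually.of_forall fun t => R.norm_grad_le _ _)

theorem memLp_grad_const (R : IsRegularFunctional F C dF DdF D2dF d2F K) {X : T → Rn n}
    (hX : MemLp X 2 π) (μ : P2 n) : MemLp (fun t => DdF μ (X t)) 2 π :=
  R.memLp_grad hX ((R.continuous_grad μ).comp_aestronglyMeasurable hX.1)

theorem integrable_inner_of_memLp {T : Type*} [MeasurableSpace T] {π : Measure T}
    {X Y : T → Rn n} (hX : MemLp X 2 π) (hY : MemLp Y 2 π) :
    Integrable (fun t => (inner ℝ (X t) (Y t) : ℝ)) π := by
  refine Integrable.mono' (hX.norm.integrable_mul hY.norm) (hX.1.inner hY.1)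
    (Eventually.of_forall fun t => norm_inner_le_norm _ _)

theorem norm_gradient_remainder_le (R : IsRegularFunctional F C dF DdF D2dF d2F K) (μ : P2 n)
    (a b : Rn n) :
    ‖dF μ b - dF μ a - inner ℝ (DdF μ a) (b - a)‖ ≤ C / 2 * ‖b - a‖ ^ 2 := by
  obtain ⟨s, -, e⟩ := R.exists_gradient_remainder μ a b
  rw [e, norm_div, Real.norm_two]
  have : ‖(inner ℝ (D2dF μ (a + s • (b - a)) (b - a)) (b - a) : ℝ)‖ ≤ C * ‖b - a‖ * ‖b - a‖ :=
    (norm_inner_le_norm _ _).trans (by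
      gcongr
      exact (ContinuousLinearMap.le_opNorm _ _).trans (by gcongr; exact R.hess_bdd _ _))
  linarith [this]

/-- The remainder of the first order expansion of `F` along laws of random vectors. -/
noncomputable def remainder (F : P2 n → ℝ) (DdF : P2 n → Rn n → Rn n) (π : Measure T)
    [IsProbabilityMeasure π] {X X' : T → Rn n} (hX : MemLp X 2 π) (hX' : MemLp X' 2 π) : ℝ :=
  F (P2.law π X' hX') - F (P2.law π X hX) -
    ∫ t, inner ℝ (DdF (P2.law π X hX) (X t)) (X' t - X t) ∂π

/-- The remainder has two sources: replacing increments of dF/dν(law X) by their linear part in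
space, and the curvature of F along the segment of measures. -/
theorem exists_remainder_eq (R : IsRegularFunctional F C dF DdF D2dF d2F K) {X X' : T → Rn n}
    (hX : MemLp X 2 π) (hX' : MemLp X' 2 π) :
    ∃ τ : unitInterval, remainder F DdF π hX hX' =
      ∫ t, (dF (P2.law π X hX) (X' t) - dF (P2.law π X hX) (X t) -
        inner ℝ (DdF (P2.law π X hX) (X t)) (X' t - X t)) ∂π +
      (∫ p : T × T, mixedDiff (d2F (P2.mix (P2.law π X hX) (P2.law π X' hX') τ))
        (X p.1) (X' p.1) (X p.2) (X' p.2) ∂(π.prod π)) / 2 := by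
  obtain ⟨τ, h⟩ := R.exists_segment_remainder (P2.law π X hX) (P2.law π X' hX')
  refine ⟨τ, ?_⟩
  rw [P2.intDiff_law hX hX' (R.continuous_dF _) (R.first.integrable _),
    P2.intDiff₂_law hX hX' (R.continuous_d2F _) (R.second.integrable _)] at h
  have e := integral_sub
    ((P2.integrable_comp_of_law hX' (R.continuous_dF _) (R.first.integrable (P2.law π X hX) _)).sub
      (P2.integrable_comp_of_law hX (R.continuous_dF _) (R.first.integrable (P2.law π X hX) _)))
    (integrable_inner_of_memLp (R.memLp_grad_const hX (P2.law π X hX)) (hX'.sub hX))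
  simp only [Pi.sub_apply] at e
  rw [e, ← h, remainder]
  ring

theorem norm_remainder_le (R : IsRegularFunctional F C dF DdF D2dF d2F K) {X X' : T → Rn n}
    (hX : MemLp X 2 π) (hX' : MemLp X' 2 π) :
    ‖remainder F DdF π hX hX'‖ ≤ C * ∫ t, ‖X' t - X t‖ ^ 2 ∂π := by
  have hL : MemLp (fun t => X' t - X t) 2 π := hX'.sub hX
  have hI : Integrable (fun t => ‖X' t - X t‖ ^ 2) π := hL.norm.integrable_sq
  obtain ⟨τ, h⟩ := R.exists_remainder_eq hX hX'
  rw [h]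
  have h1 : ‖∫ t, (dF (P2.law π X hX) (X' t) - dF (P2.law π X hX) (X t) -
        inner ℝ (DdF (P2.law π X hX) (X t)) (X' t - X t)) ∂π‖ ≤
      C / 2 * ∫ t, ‖X' t - X t‖ ^ 2 ∂π := by
    rw [← integral_const_mul]
    exact norm_integral_le_of_norm_le (hI.const_mul _)
      (Eventually.of_forall fun t => R.norm_gradient_remainder_le _ _ _)
  have h2 : ‖∫ p : T × T, mixedDiff (d2F (P2.mix (P2.law π X hX) (P2.law π X' hX') τ))
        (X p.1) (X' p.1) (X p.2) (X' p.2) ∂(π.prod π)‖ ≤ C * ∫ t, ‖X' t - X t‖ ^ 2 ∂π := by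
    have i1 := hI.comp_fst π
    have i2 := hI.comp_snd π
    -- The mixed difference is bounded by C|u||v| ≤ (C/2)(|u|² + |v|²), and both squares have the
    -- same integral.
    have e : C * ∫ t, ‖X' t - X t‖ ^ 2 ∂π = ∫ p : T × T, C / 2 * (‖X' p.1 - X p.1‖ ^ 2 +
        ‖X' p.2 - X p.2‖ ^ 2) ∂(π.prod π) := by
      rw [integral_const_mul, integral_add i1 i2,
        integral_fun_fst (fun t => ‖X' t - X t‖ ^ 2), integral_fun_snd (fun t => ‖X' t - X t‖ ^ 2)]
      simp
      ring
    rw [e]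
    refine norm_integral_le_of_norm_le ((i1.add i2).const_mul _)
      (Eventually.of_forall fun p => ?_)
    refine (norm_mixedDiff_le (R.mixed _) (R.mixed_bdd _) _ _ _ _).trans ?_
    nlinarith [mul_nonneg R.const_nonneg (sq_nonneg (‖X' p.1 - X p.1‖ - ‖X' p.2 - X p.2‖))]
  refine (norm_add_le _ _).trans ?_
  rw [norm_div, Real.norm_two]
  linarith

end IsRegularFunctional

/-! ### First and second variation along h ↦ law(X + hY). -/

/-- Intermediate points of mean value theorems depend on h without any regularity; boundedness of
`s` is enough. The parameters α, β allow expansion in both directions, (0,1) and (1,0). -/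
theorem tendsto_segment_point {E : Type*} [NormedAddCommGroup E] [NormedSpace ℝ E] (x y : E)
    (α β : ℝ) {s : ℝ → ℝ} (hs : ∀ h, s h ∈ Ioo (0 : ℝ) 1) :
    Tendsto (fun h : ℝ => x + (α * h) • y + s h • ((x + (β * h) • y) - (x + (α * h) • y)))
      (𝓝[≠] 0) (𝓝 x) := by
  have hid : Tendsto (fun h : ℝ => h) (𝓝[≠] 0) (𝓝 0) := nhdsWithin_le_nhds
  have h1 : Tendsto (fun h : ℝ => s h * h) (𝓝[≠] 0) (𝓝 0) := by
    refine squeeze_zero_norm (a := fun h : ℝ => |h|) (fun h => ?_) (by simpa using hid.abs)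
    rw [norm_mul, Real.norm_eq_abs, Real.norm_eq_abs, abs_of_pos (hs h).1]
    exact mul_le_of_le_one_left (abs_nonneg _) (hs h).2.le
  have h2 : Tendsto (fun h : ℝ => x + (α * h) • y + ((β - α) * (s h * h)) • y) (𝓝[≠] 0)
      (𝓝 (x + (α * 0) • y + ((β - α) * 0) • y)) :=
    (((hid.const_mul α).smul_const y).const_add x).add ((h1.const_mul (β - α)).smul_const y)
  simp only [mul_zero, zero_smul, add_zero] at h2
  refine h2.congr fun h => ?_
  module

theorem memLp_curve {n : ℕ} {T : Type*} [MeasurableSpace T] {π : Measure T}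
    {X Y : T → Rn n} (hX : MemLp X 2 π) (hY : MemLp Y 2 π) (c : ℝ) :
    MemLp (fun t => X t + c • Y t) 2 π :=
  hX.add (hY.const_smul c)

theorem tendsto_eLpNorm_curve {n : ℕ} {T : Type*} [MeasurableSpace T] {π : Measure T}
    {X Y : T → Rn n} (hY : MemLp Y 2 π) (α : ℝ) :
    Tendsto (fun h : ℝ => eLpNorm ((fun t => X t + (α * h) • Y t) - X) 2 π) (𝓝[≠] 0) (𝓝 0) := by
  have e : ∀ h : ℝ, eLpNorm ((fun t => X t + (α * h) • Y t) - X) 2 π =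
      ‖α * h‖ₑ * eLpNorm Y 2 π := fun h => by
    rw [← eLpNorm_const_smul]
    congr 1
    ext1 t
    simp
  simp only [e]
  have h1 : Tendsto (fun h : ℝ => ‖α * h‖ₑ) (𝓝[≠] 0) (𝓝 0) := by
    have : Continuous fun h : ℝ => ‖α * h‖ₑ := by fun_prop
    simpa using (this.tendsto 0).mono_left nhdsWithin_le_nhds
  simpa using ENNReal.Tendsto.mul_const h1 (Or.inr hY.eLpNorm_ne_top)

namespace IsRegularFunctional

variable {n : ℕ} {F : P2 n → ℝ} {C : ℝ} {dF : P2 n → Rn n → ℝ}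
  {DdF : P2 n → Rn n → Rn n} {D2dF : P2 n → Rn n → Rn n →L[ℝ] Rn n}
  {d2F : P2 n → Rn n → Rn n → ℝ} {K : P2 n → Rn n → Rn n → Rn n →L[ℝ] Rn n}
  {T : Type*} [MeasurableSpace T] {π : Measure T} [IsProbabilityMeasure π]

/-- The measure moves with h because the backward expansion is based at law(X + hY); joint
continuity of the Hessian absorbs this. -/
theorem tendsto_gradient_remainder (R : IsRegularFunctional F C dF DdF D2dF d2F K) {μ : P2 n}
    {ρ : ℝ → P2 n} (hρ : Tendsto ρ (𝓝[≠] 0) (𝓝 μ)) (α β : ℝ) (x y : Rn n) :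
    Tendsto (fun h : ℝ => (h ^ 2)⁻¹ * (dF (ρ h) (x + (β * h) • y) - dF (ρ h) (x + (α * h) • y) -
      inner ℝ (DdF (ρ h) (x + (α * h) • y)) ((x + (β * h) • y) - (x + (α * h) • y))))
      (𝓝[≠] 0) (𝓝 ((β - α) ^ 2 / 2 * inner ℝ (D2dF μ x y) y)) := by
  choose s hs e using fun h : ℝ =>
    R.exists_gradient_remainder (ρ h) (x + (α * h) • y) (x + (β * h) • y)
  have h1 := (R.hess_cont.tendsto (μ, x)).comp
    (hρ.prodMk_nhds (tendsto_segment_point x y α β hs))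
  have hc : Continuous fun A : Rn n →L[ℝ] Rn n => (β - α) ^ 2 / 2 * (inner ℝ (A y) y : ℝ) := by
    fun_prop
  refine ((hc.tendsto _).comp h1).congr' ?_
  filter_upwards [self_mem_nhdsWithin] with h hh
  have hh : h ≠ 0 := hh
  simp only [Function.comp_apply]
  rw [e, show (x + (β * h) • y) - (x + (α * h) • y) = ((β - α) * h) • y by module]
  simp only [map_smul, real_inner_smul_left, real_inner_smul_right]
  field_simp

theorem tendsto_mixedDiff (R : IsRegularFunctional F C dF DdF D2dF d2F K) {μ : P2 n}
    {ρ : ℝ → P2 n} (hρ : Tendsto ρ (𝓝[≠] 0) (𝓝 μ)) (α β : ℝ) (x y x' y' : Rn n) :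
    Tendsto (fun h : ℝ => (h ^ 2)⁻¹ * mixedDiff (d2F (ρ h)) (x + (α * h) • y) (x + (β * h) • y)
      (x' + (α * h) • y') (x' + (β * h) • y'))
      (𝓝[≠] 0) (𝓝 ((β - α) ^ 2 * inner ℝ (K μ x x' y') y)) := by
  choose s hs t ht e using fun h : ℝ =>
    (R.mixed (ρ h)).exists_mixedDiff_eq (x + (α * h) • y) (x + (β * h) • y)
      (x' + (α * h) • y') (x' + (β * h) • y')
  have h1 := (R.mixed_cont.tendsto (μ, x, x')).comp
    (hρ.prodMk_nhds ((tendsto_segment_point x y α β hs).prodMk_nhds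
      (tendsto_segment_point x' y' α β ht)))
  have hc : Continuous fun A : Rn n →L[ℝ] Rn n => (β - α) ^ 2 * (inner ℝ (A y') y : ℝ) := by
    fun_prop
  refine ((hc.tendsto _).comp h1).congr' ?_
  filter_upwards [self_mem_nhdsWithin] with h hh
  have hh : h ≠ 0 := hh
  simp only [Function.comp_apply]
  rw [e, show (x + (β * h) • y) - (x + (α * h) • y) = ((β - α) * h) • y by module,
    show (x' + (β * h) • y') - (x' + (α * h) • y') = ((β - α) * h) • y' by module]
  simp only [map_smul, real_inner_smul_left, real_inner_smul_right]
  field_simp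

theorem tendsto_integral_gradient_remainder (R : IsRegularFunctional F C dF DdF D2dF d2F K)
    {X Y : T → Rn n} (hX : MemLp X 2 π) (hY : MemLp Y 2 π) {μ : P2 n}
    {ρ : ℝ → P2 n} (hρ : Tendsto ρ (𝓝[≠] 0) (𝓝 μ)) (α β : ℝ) :
    Tendsto (fun h : ℝ => (h ^ 2)⁻¹ * ∫ t, (dF (ρ h) (X t + (β * h) • Y t) -
      dF (ρ h) (X t + (α * h) • Y t) - inner ℝ (DdF (ρ h) (X t + (α * h) • Y t))
        ((X t + (β * h) • Y t) - (X t + (α * h) • Y t))) ∂π)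
      (𝓝[≠] 0) (𝓝 ((β - α) ^ 2 / 2 * ∫ t, inner ℝ (D2dF μ (X t) (Y t)) (Y t) ∂π)) := by
  simp only [← integral_const_mul]
  refine tendsto_integral_filter_of_dominated_convergence
    (fun t => C / 2 * (β - α) ^ 2 * ‖Y t‖ ^ 2) (Eventually.of_forall fun h => ?_) ?_
    (hY.norm.integrable_sq.const_mul _)
    (Eventually.of_forall fun t => R.tendsto_gradient_remainder hρ α β _ _)
  · have a := (memLp_curve hX hY (α * h)).1
    have b := (memLp_curve hX hY (β * h)).1
    exact ((((R.continuous_dF _).comp_aestronglyMeasurable b).sub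
      ((R.continuous_dF _).comp_aestronglyMeasurable a)).sub
      (((R.continuous_grad _).comp_aestronglyMeasurable a).inner (b.sub a))).const_mul _
  · filter_upwards [self_mem_nhdsWithin] with h hh
    have hh : h ≠ 0 := hh
    refine Eventually.of_forall fun t => ?_
    have := R.norm_gradient_remainder_le (ρ h) (X t + (α * h) • Y t) (X t + (β * h) • Y t)
    rw [show (X t + (β * h) • Y t) - (X t + (α * h) • Y t) = ((β - α) * h) • Y t by module] at this ⊢
    rw [norm_mul, norm_inv, norm_pow, Real.norm_eq_abs h, sq_abs, inv_mul_le_iff₀ (by positivity)]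
    refine this.trans_eq ?_
    rw [norm_smul, mul_pow, Real.norm_eq_abs, sq_abs]
    ring

theorem tendsto_integral_mixedDiff (R : IsRegularFunctional F C dF DdF D2dF d2F K)
    {X Y : T → Rn n} (hX : MemLp X 2 π) (hY : MemLp Y 2 π) {μ : P2 n}
    {ρ : ℝ → P2 n} (hρ : Tendsto ρ (𝓝[≠] 0) (𝓝 μ)) (α β : ℝ) :
    Tendsto (fun h : ℝ => (h ^ 2)⁻¹ * ∫ p : T × T, mixedDiff (d2F (ρ h)) (X p.1 + (α * h) • Y p.1)
      (X p.1 + (β * h) • Y p.1) (X p.2 + (α * h) • Y p.2) (X p.2 + (β * h) • Y p.2) ∂(π.prod π))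
      (𝓝[≠] 0) (𝓝 ((β - α) ^ 2 *
        ∫ p : T × T, inner ℝ (K μ (X p.1) (X p.2) (Y p.2)) (Y p.1) ∂(π.prod π))) := by
  simp only [← integral_const_mul]
  have i1 : Integrable (fun p : T × T => ‖Y p.1‖ * ‖Y p.2‖) (π.prod π) :=
    (hY.integrable one_le_two).norm.mul_prod (hY.integrable one_le_two).norm
  refine tendsto_integral_filter_of_dominated_convergence
    (fun p => C * (β - α) ^ 2 * (‖Y p.1‖ * ‖Y p.2‖)) (Eventually.of_forall fun h => ?_) ?_
    (i1.const_mul _)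
    (Eventually.of_forall fun t => R.tendsto_mixedDiff hρ α β _ _ _ _)
  · have a := (memLp_curve hX hY (α * h)).1
    have b := (memLp_curve hX hY (β * h)).1
    have m := fun {U V : T → Rn n} (hU : AEStronglyMeasurable U π)
      (hV : AEStronglyMeasurable V π) => (R.continuous_d2F (ρ h)).comp_aestronglyMeasurable
        ((hU.comp_fst (ν := π)).prodMk (hV.comp_snd (μ := π)))
    exact (((m b b).sub (m b a)).sub ((m a b).sub (m a a))).const_mul _
  · filter_upwards [self_mem_nhdsWithin] with h hh
    have hh : h ≠ 0 := hh
    refine Eventually.of_forall fun p => ?_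
    have := norm_mixedDiff_le (R.mixed (ρ h)) (R.mixed_bdd _) (X p.1 + (α * h) • Y p.1)
      (X p.1 + (β * h) • Y p.1) (X p.2 + (α * h) • Y p.2) (X p.2 + (β * h) • Y p.2)
    rw [show (X p.1 + (β * h) • Y p.1) - (X p.1 + (α * h) • Y p.1) = ((β - α) * h) • Y p.1 by module,
      show (X p.2 + (β * h) • Y p.2) - (X p.2 + (α * h) • Y p.2) = ((β - α) * h) • Y p.2 by module]
      at this
    rw [norm_mul, norm_inv, norm_pow, Real.norm_eq_abs h, sq_abs, inv_mul_le_iff₀ (by positivity)]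
    refine this.trans_eq ?_
    rw [norm_smul, norm_smul, Real.norm_eq_abs]
    linear_combination C * ‖Y p.1‖ * ‖Y p.2‖ * sq_abs ((β - α) * h)

/-- The second derivative at `0` of `h ↦ F (law (X + h Y))`. -/
noncomputable def secondVariation (D2dF : P2 n → Rn n → Rn n →L[ℝ] Rn n)
    (K : P2 n → Rn n → Rn n → Rn n →L[ℝ] Rn n) (π : Measure T) (μ : P2 n) (X Y : T → Rn n) : ℝ :=
  ∫ t, inner ℝ (D2dF μ (X t) (Y t)) (Y t) ∂π +
    ∫ p : T × T, inner ℝ (K μ (X p.1) (X p.2) (Y p.2)) (Y p.1) ∂(π.prod π)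

theorem tendsto_remainder (R : IsRegularFunctional F C dF DdF D2dF d2F K)
    {X Y : T → Rn n} (hX : MemLp X 2 π) (hY : MemLp Y 2 π) (α β : ℝ) :
    Tendsto (fun h : ℝ => (h ^ 2)⁻¹ * remainder F DdF π (memLp_curve hX hY (α * h))
      (memLp_curve hX hY (β * h))) (𝓝[≠] 0)
      (𝓝 ((β - α) ^ 2 / 2 * secondVariation D2dF K π (P2.law π X hX) X Y)) := by
  choose τ hτ using fun h : ℝ =>
    R.exists_remainder_eq (memLp_curve hX hY (α * h)) (memLp_curve hX hY (β * h))
  have h1 := R.tendsto_integral_gradient_remainder hX hY (P2.tendsto_law hX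
    (fun h : ℝ => memLp_curve hX hY (α * h)) (tendsto_eLpNorm_curve hY α)) α β
  have h2 := R.tendsto_integral_mixedDiff hX hY (P2.tendsto_mix_law hX
    (fun h : ℝ => memLp_curve hX hY (α * h)) (fun h : ℝ => memLp_curve hX hY (β * h)) τ
    (tendsto_eLpNorm_curve hY α) (tendsto_eLpNorm_curve hY β)) α β
  convert h1.add (h2.div_const 2) using 1
  · funext h
    rw [hτ h]
    ring
  · rw [secondVariation]
    congr 1
    ring

/-- The derivative of `h ↦ F (law (X + h Y))`. -/
noncomputable def firstVariation (DdF : P2 n → Rn n → Rn n) (π : Measure T)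
    [IsProbabilityMeasure π] {X Y : T → Rn n} (hX : MemLp X 2 π) (hY : MemLp Y 2 π) (h : ℝ) : ℝ :=
  ∫ t, inner ℝ (DdF (P2.law π _ (memLp_curve hX hY h)) (X t + h • Y t)) (Y t) ∂π

/-- The forward and backward expansions are added, so that the values of F cancel. This trades the
dependence of D dF/dν on the measure for remainders of F, which are under control. -/
theorem firstVariation_sub (F : P2 n → ℝ) {DdF : P2 n → Rn n → Rn n} {X Y : T → Rn n}
    (hX : MemLp X 2 π) (hY : MemLp Y 2 π) (h : ℝ) :
    h * (firstVariation DdF π hX hY h - firstVariation DdF π hX hY 0) =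
      remainder F DdF π (memLp_curve hX hY 0) (memLp_curve hX hY h) +
      remainder F DdF π (memLp_curve hX hY h) (memLp_curve hX hY 0) := by
  have e : ∀ a b : ℝ, ∫ t, inner ℝ (DdF (P2.law π _ (memLp_curve hX hY a)) (X t + a • Y t))
      ((X t + b • Y t) - (X t + a • Y t)) ∂π = (b - a) * firstVariation DdF π hX hY a := by
    intro a b
    rw [firstVariation, ← integral_const_mul]
    refine integral_congr_ae (Eventually.of_forall fun t => ?_)
    simp only
    rw [show (X t + b • Y t) - (X t + a • Y t) = (b - a) • Y t by module, real_inner_smul_right]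
  unfold remainder
  rw [e, e]
  ring

/-- The factor 2 counts the two remainders. The bound is uniform in h and serves as the dominating
function when averaging over ω. -/
theorem norm_firstVariation_sub_le (R : IsRegularFunctional F C dF DdF D2dF d2F K)
    {X Y : T → Rn n} (hX : MemLp X 2 π) (hY : MemLp Y 2 π) {h : ℝ} (hh : h ≠ 0) :
    ‖h⁻¹ * (firstVariation DdF π hX hY h - firstVariation DdF π hX hY 0)‖ ≤
      2 * C * ∫ t, ‖Y t‖ ^ 2 ∂π := by
  have e := firstVariation_sub F (DdF := DdF) hX hY h
  have b : ∀ a b : ℝ, ‖remainder F DdF π (memLp_curve hX hY a) (memLp_curve hX hY b)‖ ≤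
      (b - a) ^ 2 * (C * ∫ t, ‖Y t‖ ^ 2 ∂π) := by
    intro a b
    refine (R.norm_remainder_le _ _).trans_eq ?_
    rw [← mul_assoc, mul_comm _ C, mul_assoc, ← integral_const_mul ((b - a) ^ 2)]
    congr 2
    funext t
    rw [show (X t + b • Y t) - (X t + a • Y t) = (b - a) • Y t by module, norm_smul, mul_pow,
      Real.norm_eq_abs, sq_abs]
  have hpos : 0 < h ^ 2 := by positivity
  have e2 : h⁻¹ * (firstVariation DdF π hX hY h - firstVariation DdF π hX hY 0) =
      (h ^ 2)⁻¹ * (h * (firstVariation DdF π hX hY h - firstVariation DdF π hX hY 0)) := by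
    field_simp
  rw [e2, e, norm_mul, norm_inv, norm_pow, Real.norm_eq_abs h, sq_abs, inv_mul_le_iff₀ hpos]
  refine (norm_add_le _ _).trans ((add_le_add (b _ _) (b _ _)).trans_eq ?_)
  ring

theorem tendsto_firstVariation (R : IsRegularFunctional F C dF DdF D2dF d2F K)
    {X Y : T → Rn n} (hX : MemLp X 2 π) (hY : MemLp Y 2 π) :
    Tendsto (fun h : ℝ => h⁻¹ * (firstVariation DdF π hX hY h - firstVariation DdF π hX hY 0))
      (𝓝[≠] 0) (𝓝 (secondVariation D2dF K π (P2.law π X hX) X Y)) := by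
  have h1 := (R.tendsto_remainder hX hY 0 1).add (R.tendsto_remainder hX hY 1 0)
  have h2 : (1 - 0 : ℝ) ^ 2 / 2 * secondVariation D2dF K π (P2.law π X hX) X Y +
      (0 - 1 : ℝ) ^ 2 / 2 * secondVariation D2dF K π (P2.law π X hX) X Y =
      secondVariation D2dF K π (P2.law π X hX) X Y := by ring
  rw [h2] at h1
  refine h1.congr' ?_
  filter_upwards [self_mem_nhdsWithin] with h hh
  have hh : h ≠ 0 := hh
  have e := firstVariation_sub F (DdF := DdF) hX hY h
  rw [← mul_add]
  simp only [zero_mul, one_mul]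
  rw [← e]
  field_simp

end IsRegularFunctional

/-! ### Symmetry of the second derivatives. -/

namespace IsRegularFunctional

variable {n : ℕ} {F : P2 n → ℝ} {C : ℝ} {dF : P2 n → Rn n → ℝ}
  {DdF : P2 n → Rn n → Rn n} {D2dF : P2 n → Rn n → Rn n →L[ℝ] Rn n}
  {d2F : P2 n → Rn n → Rn n → ℝ} {K : P2 n → Rn n → Rn n → Rn n →L[ℝ] Rn n}

theorem inner_hess_comm (R : IsRegularFunctional F C dF DdF D2dF d2F K) (μ : P2 n)
    (x v w : Rn n) : (inner ℝ (D2dF μ x v) w : ℝ) = inner ℝ (D2dF μ x w) v := by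
  have h1 : ∀ y, HasFDerivAt (dF μ) (innerSL ℝ (DdF μ y)) y := fun y =>
    (R.grad μ y).hasFDerivAt
  have h2 : HasFDerivAt (fun y => innerSL ℝ (DdF μ y)) ((innerSL ℝ).comp (D2dF μ x)) x :=
    (innerSL ℝ (E := Rn n)).hasFDerivAt.comp x (R.hess μ x)
  exact second_derivative_symmetric h1 h2 v w

/-- Both sides are limits of rescaled mixed differences, which are invariant under exchange of the
two arguments when `d2F` is symmetric. -/
theorem inner_mixed_comm (R : IsRegularFunctional F C dF DdF D2dF d2F K)
    (hsymm : ∀ μ x x', d2F μ x x' = d2F μ x' x) (μ : P2 n) (x x' y y' : Rn n) :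
    (inner ℝ (K μ x x' y') y : ℝ) = inner ℝ (K μ x' x y) y' := by
  have h1 := R.tendsto_mixedDiff (ρ := fun _ => μ) tendsto_const_nhds 0 1 x y x' y'
  have h2 := R.tendsto_mixedDiff (ρ := fun _ => μ) tendsto_const_nhds 0 1 x' y' x y
  have e : ∀ a b a' b', mixedDiff (d2F μ) a b a' b' = mixedDiff (d2F μ) a' b' a b := by
    intro a b a' b'
    simp only [mixedDiff]
    rw [hsymm μ b' b, hsymm μ b' a, hsymm μ a' b, hsymm μ a' a]
    ring
  simpa using tendsto_nhds_unique h1 (h2.congr fun h => by rw [e])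

end IsRegularFunctional

/-! ### Disintegration and conditional laws as random elements of 𝒫₂. -/

section CondDistrib

variable {S Ω₀ V E : Type*} [MeasurableSpace S] [MeasurableSpace Ω₀] {M : Measure S}
  [IsProbabilityMeasure M] {X : S → Ω₀} [MeasurableSpace V] [StandardBorelSpace V] [Nonempty V]
  [NormedAddCommGroup E] [NormedSpace ℝ E]

/-- Disintegration of an integral along the conditional distribution. -/
theorem integral_condDistrib_disintegration (hX : Measurable X) {U : S → V} (hU : AEMeasurable U M)
    {f : Ω₀ × V → E} (hf : StronglyMeasurable f) (hi : Integrable (fun p => f (X p, U p)) M) :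
    (∀ᵐ ω ∂M.map X, Integrable (fun v => f (ω, v)) (condDistrib U X M ω)) ∧
    Integrable (fun ω => ∫ v, f (ω, v) ∂condDistrib U X M ω) (M.map X) ∧
    ∫ ω, ∫ v, f (ω, v) ∂condDistrib U X M ω ∂M.map X = ∫ p, f (X p, U p) ∂M := by
  have hm : AEMeasurable (fun p => (X p, U p)) M := hX.aemeasurable.prodMk hU
  have hi' : Integrable f (M.map fun p => (X p, U p)) :=
    (integrable_map_measure hf.aestronglyMeasurable hm).2 hi
  refine ⟨hi'.condDistrib_ae_map hU, hi'.integral_condDistrib_map hU, ?_⟩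
  rw [← integral_map hm hf.aestronglyMeasurable]
  rw [← compProd_map_condDistrib hU] at hi' ⊢
  exact (Measure.integral_compProd hi').symm

theorem ae_memLp_condDistrib {n : ℕ} (hX : Measurable X) {U : S → V} (hU : AEMeasurable U M)
    {g : V → Rn n} (hg : Measurable g) (hL : MemLp (fun p => g (U p)) 2 M) :
    (∀ᵐ ω ∂M.map X, MemLp g 2 (condDistrib U X M ω)) ∧
    Integrable (fun ω => ∫ v, ‖g v‖ ^ 2 ∂condDistrib U X M ω) (M.map X) ∧
    ∫ ω, ∫ v, ‖g v‖ ^ 2 ∂condDistrib U X M ω ∂M.map X = ∫ p, ‖g (U p)‖ ^ 2 ∂M := by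
  have hs : StronglyMeasurable fun q : Ω₀ × V => ‖g q.2‖ ^ 2 :=
    (by fun_prop : Measurable fun q : Ω₀ × V => ‖g q.2‖ ^ 2).stronglyMeasurable
  obtain ⟨h1, h2, h3⟩ := integral_condDistrib_disintegration hX hU hs hL.norm.integrable_sq
  refine ⟨?_, h2, h3⟩
  filter_upwards [h1] with ω hω
  exact (memLp_two_iff_integrable_sq_norm hg.aestronglyMeasurable).2 hω

end CondDistrib

section ConditionalLaw

variable {n : ℕ} {S Ω₀ : Type*} [MeasurableSpace S] [MeasurableSpace Ω₀]

open Classical in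
/-- The conditional law of a random vector, as a random element of the Wasserstein space. -/
noncomputable def conditionalLaw (M : Measure S) [IsProbabilityMeasure M] (X : S → Ω₀)
    (Z : S → Rn n) (ω : Ω₀) : P2 n :=
  if h : MemLp id 2 (condDistrib Z X M ω) then
    { toMeasure := condDistrib Z X M ω
      isProb := inferInstance
      memLp_id := h }
  else P2.diracZero n

variable {M : Measure S} [IsProbabilityMeasure M] {X : S → Ω₀}

theorem conditionalLaw_congr {Z Z' : S → Rn n} (h : Z =ᵐ[M] Z') :
    conditionalLaw M X Z = conditionalLaw M X Z' := by
  funext ω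
  have e : condDistrib Z X M ω = condDistrib Z' X M ω := by rw [condDistrib_congr_left h]
  by_cases hm : MemLp id 2 (condDistrib Z X M ω)
  · rw [conditionalLaw, conditionalLaw, dif_pos hm, dif_pos (by rwa [← e])]
    exact P2.ext_toMeasure e
  · rw [conditionalLaw, conditionalLaw, dif_neg hm, dif_neg (by rwa [← e])]

theorem stronglyMeasurable_conditionalLaw (Z : S → Rn n) :
    StronglyMeasurable (conditionalLaw M X Z) := by
  classical
  apply P2.stronglyMeasurable_of_measurable
  -- Finiteness of the second moment is a measurable condition, so switching to the default value
  -- elsewhere keeps measurability.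
  have hs : MeasurableSet {ω | MemLp id 2 (condDistrib Z X M ω)} := by
    have : StronglyMeasurable fun x : Rn n => ‖x‖ ^ 2 :=
      (by fun_prop : Continuous fun x : Rn n => ‖x‖ ^ 2).stronglyMeasurable
    convert measurableSet_integrable (κ := condDistrib Z X M) this using 1
    ext ω
    exact memLp_two_iff_integrable_sq_norm aestronglyMeasurable_id
  have e : (fun ω => (conditionalLaw M X Z ω).toMeasure) =
      fun ω => if MemLp id 2 (condDistrib Z X M ω) then condDistrib Z X M ω
        else (P2.diracZero n).toMeasure := by
    funext ω
    unfold conditionalLaw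
    split_ifs <;> rfl
  rw [e]
  exact Measurable.ite hs (condDistrib Z X M).measurable measurable_const

/-- For fixed ω, the conditional law becomes the law of `g` on the probability space (V, κ(ω)),
where the unconditional results apply. With U = (Z,Y), one kernel serves all the fields Z + εY. -/
theorem conditionalLaw_comp_ae {V : Type*} [MeasurableSpace V] [StandardBorelSpace V] [Nonempty V]
    (hX : Measurable X) {U : S → V} (hU : AEMeasurable U M)
    {g : V → Rn n} (hg : Measurable g) (hL : MemLp (fun p => g (U p)) 2 M) :
    ∀ᵐ ω ∂M.map X, ∃ h : MemLp g 2 (condDistrib U X M ω),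
      conditionalLaw M X (fun p => g (U p)) ω = P2.law (condDistrib U X M ω) g h := by
  filter_upwards [(ae_memLp_condDistrib hX hU hg hL).1, condDistrib_comp X hU hg] with ω h1 h2
  refine ⟨h1, P2.ext_toMeasure ?_⟩
  have h2' : condDistrib (fun p => g (U p)) X M ω = (condDistrib U X M ω).map g := by
    rw [← Kernel.map_apply _ hg]; exact h2
  have h3 : MemLp id 2 (condDistrib (fun p => g (U p)) X M ω) := by
    rw [h2', memLp_map_measure_iff aestronglyMeasurable_id hg.aemeasurable]
    exact h1
  rw [conditionalLaw, dif_pos h3]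
  exact h2'

end ConditionalLaw

theorem sq_integral_norm_le {T E : Type*} [MeasurableSpace T] {π : Measure T}
    [IsProbabilityMeasure π] [NormedAddCommGroup E] {Y : T → E} (hY : MemLp Y 2 π) :
    (∫ t, ‖Y t‖ ∂π) ^ 2 ≤ ∫ t, ‖Y t‖ ^ 2 ∂π := by
  set a := ∫ t, ‖Y t‖ ∂π with ha
  have h1 : Integrable (fun t => ‖Y t‖) π := (hY.integrable one_le_two).norm
  have h2 : Integrable (fun t => ‖Y t‖ ^ 2) π := hY.norm.integrable_sq
  -- Nonnegativity of the variance of |Y|.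
  have h3 : 0 ≤ ∫ t, (‖Y t‖ - a) ^ 2 ∂π := integral_nonneg fun t => sq_nonneg _
  have h4 : ∫ t, (‖Y t‖ - a) ^ 2 ∂π = ∫ t, ‖Y t‖ ^ 2 ∂π - 2 * a * a + a ^ 2 := by
    have : ∀ t, (‖Y t‖ - a) ^ 2 = ‖Y t‖ ^ 2 - 2 * a * ‖Y t‖ + a ^ 2 := fun t => by ring
    simp only [this]
    rw [integral_add (f := fun t => ‖Y t‖ ^ 2 - 2 * a * ‖Y t‖)
      (h2.sub (h1.const_mul _)) (integrable_const _), integral_sub h2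
      (h1.const_mul _), integral_const_mul, ← ha]
    simp
  nlinarith

/-! ### The lifted functional and its Gâteaux gradient. -/

namespace IsRegularFunctional

variable {n : ℕ} {F : P2 n → ℝ} {C : ℝ} {dF : P2 n → Rn n → ℝ}
  {DdF : P2 n → Rn n → Rn n} {D2dF : P2 n → Rn n → Rn n →L[ℝ] Rn n}
  {d2F : P2 n → Rn n → Rn n → ℝ} {K : P2 n → Rn n → Rn n → Rn n →L[ℝ] Rn n}
  {S Ω₀ : Type*} [MeasurableSpace S] [MeasurableSpace Ω₀]
  {M : Measure S} [IsProbabilityMeasure M] {X : S → Ω₀}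

theorem integrable_conditionalLaw (R : IsRegularFunctional F C dF DdF D2dF d2F K)
    (hX : Measurable X) {Z : S → Rn n} (hZ : MemLp Z 2 M) :
    Integrable (fun ω => F (conditionalLaw M X Z ω)) (M.map X) := by
  have : IsProbabilityMeasure (M.map X) := Measure.isProbabilityMeasure_map hX.aemeasurable
  have h := ae_memLp_condDistrib hX hZ.1.aemeasurable measurable_id hZ
  refine Integrable.mono' (((integrable_const (1 : ℝ)).add h.2.1).const_mul C)
    (R.cont.comp_stronglyMeasurable (stronglyMeasurable_conditionalLaw Z)).aestronglyMeasurable ?_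
  filter_upwards [conditionalLaw_comp_ae hX hZ.1.aemeasurable measurable_id hZ] with ω ⟨h1, h2⟩
  have h2 : conditionalLaw M X Z ω = _ := h2
  refine (R.growth _).trans_eq ?_
  rw [h2]
  simp only [P2.law, Measure.map_id, Pi.add_apply, id]

theorem stronglyMeasurable_grad (R : IsRegularFunctional F C dF DdF D2dF d2F K)
    {A : Type*} [MeasurableSpace A] {κ : A → P2 n} (hκ : StronglyMeasurable κ) {g : A → Rn n}
    (hg : StronglyMeasurable g) : StronglyMeasurable fun a => DdF (κ a) (g a) :=
  R.grad_cont.comp_stronglyMeasurable (hκ.prodMk hg)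

theorem stronglyMeasurable_hess (R : IsRegularFunctional F C dF DdF D2dF d2F K)
    {A : Type*} [MeasurableSpace A] {κ : A → P2 n} (hκ : StronglyMeasurable κ) {g v : A → Rn n}
    (hg : StronglyMeasurable g) (hv : StronglyMeasurable v) :
    StronglyMeasurable fun a => D2dF (κ a) (g a) (v a) :=
  isBoundedBilinearMap_apply.continuous.comp_stronglyMeasurable
    ((R.hess_cont.comp_stronglyMeasurable (hκ.prodMk hg)).prodMk hv)

theorem stronglyMeasurable_mixed (R : IsRegularFunctional F C dF DdF D2dF d2F K)
    {A : Type*} [MeasurableSpace A] {κ : A → P2 n} (hκ : StronglyMeasurable κ) {g g' v : A → Rn n}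
    (hg : StronglyMeasurable g) (hg' : StronglyMeasurable g') (hv : StronglyMeasurable v) :
    StronglyMeasurable fun a => K (κ a) (g a) (g' a) (v a) :=
  isBoundedBilinearMap_apply.continuous.comp_stronglyMeasurable
    ((R.mixed_cont.comp_stronglyMeasurable (hκ.prodMk (hg.prodMk hg'))).prodMk hv)

theorem memLp_gradField (R : IsRegularFunctional F C dF DdF D2dF d2F K)
    (hX : Measurable X) (Z : Lp (Rn n) 2 M) :
    MemLp (fun p => DdF (conditionalLaw M X Z (X p)) (Z p)) 2 M :=
  R.memLp_grad (Lp.memLp Z) (R.stronglyMeasurable_grad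
    ((stronglyMeasurable_conditionalLaw _).comp_measurable hX)
    (Lp.stronglyMeasurable Z)).aestronglyMeasurable

/-- The Gâteaux gradient of the lifted functional. -/
noncomputable def gradField (R : IsRegularFunctional F C dF DdF D2dF d2F K)
    (hX : Measurable X) (Z : Lp (Rn n) 2 M) : Lp (Rn n) 2 M :=
  (R.memLp_gradField hX Z).toLp _

theorem measurable_pair (Z Y : Lp (Rn n) 2 M) : Measurable fun p => (Z p, Y p) :=
  (Lp.stronglyMeasurable Z).measurable.prodMk (Lp.stronglyMeasurable Y).measurable

theorem ae_memLp_fst (hX : Measurable X) (Z Y : Lp (Rn n) 2 M) : ∀ᵐ ω ∂M.map X,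
    MemLp (Prod.fst : Rn n × Rn n → Rn n) 2 (condDistrib (fun p => (Z p, Y p)) X M ω) :=
  (ae_memLp_condDistrib hX (measurable_pair Z Y).aemeasurable measurable_fst (Lp.memLp Z)).1

theorem ae_memLp_snd (hX : Measurable X) (Z Y : Lp (Rn n) 2 M) : ∀ᵐ ω ∂M.map X,
    MemLp (Prod.snd : Rn n × Rn n → Rn n) 2 (condDistrib (fun p => (Z p, Y p)) X M ω) :=
  (ae_memLp_condDistrib hX (measurable_pair Z Y).aemeasurable measurable_snd (Lp.memLp Y)).1

theorem coeFn_curve (Z Y : Lp (Rn n) 2 M) (ε : ℝ) :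
    (Z + ε • Y : Lp (Rn n) 2 M) =ᵐ[M] fun p => Z p + ε • Y p := by
  filter_upwards [Lp.coeFn_add Z (ε • Y), Lp.coeFn_smul ε Y] with p h1 h2
  rw [h1, Pi.add_apply, h2, Pi.smul_apply]

theorem conditionalLaw_curve_ae (hX : Measurable X) (Z Y : Lp (Rn n) 2 M) (ε : ℝ) :
    ∀ᵐ ω ∂M.map X, ∃ h : MemLp (fun q : Rn n × Rn n => q.1 + ε • q.2) 2
      (condDistrib (fun p => (Z p, Y p)) X M ω),
      conditionalLaw M X (Z + ε • Y : Lp (Rn n) 2 M) ω =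
        P2.law (condDistrib (fun p => (Z p, Y p)) X M ω) _ h := by
  rw [conditionalLaw_congr (coeFn_curve Z Y ε)]
  exact conditionalLaw_comp_ae hX (measurable_pair Z Y).aemeasurable
    (g := fun q : Rn n × Rn n => q.1 + ε • q.2) (by fun_prop)
    (memLp_curve (Lp.memLp Z) (Lp.memLp Y) ε)

theorem conditionalLaw_fst_ae (hX : Measurable X) (Z Y : Lp (Rn n) 2 M) :
    ∀ᵐ ω ∂M.map X, ∃ h : MemLp (Prod.fst : Rn n × Rn n → Rn n) 2
      (condDistrib (fun p => (Z p, Y p)) X M ω),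
      conditionalLaw M X Z ω = P2.law (condDistrib (fun p => (Z p, Y p)) X M ω) _ h :=
  conditionalLaw_comp_ae hX (measurable_pair Z Y).aemeasurable measurable_fst (Lp.memLp Z)

/-- Disintegration turns the pairing of the gradient with Y into an average over ω of first
variations under κ(ω). -/
theorem integrable_inner_gradField (R : IsRegularFunctional F C dF DdF D2dF d2F K)
    (hX : Measurable X) (Z Y : Lp (Rn n) 2 M) (ε : ℝ) :
    Integrable (fun ω => ∫ q, (inner ℝ (DdF (conditionalLaw M X (Z + ε • Y : Lp (Rn n) 2 M) ω)
      (q.1 + ε • q.2)) q.2 : ℝ) ∂condDistrib (fun p => (Z p, Y p)) X M ω) (M.map X) ∧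
    ∫ ω, ∫ q, (inner ℝ (DdF (conditionalLaw M X (Z + ε • Y : Lp (Rn n) 2 M) ω)
      (q.1 + ε • q.2)) q.2 : ℝ) ∂condDistrib (fun p => (Z p, Y p)) X M ω ∂M.map X =
      inner ℝ (R.gradField hX (Z + ε • Y)) Y := by
  have hs : StronglyMeasurable fun a : Ω₀ × (Rn n × Rn n) =>
      (inner ℝ (DdF (conditionalLaw M X (Z + ε • Y : Lp (Rn n) 2 M) a.1)
        (a.2.1 + ε • a.2.2)) a.2.2 : ℝ) :=
    (R.stronglyMeasurable_grad ((stronglyMeasurable_conditionalLaw _).comp_measurable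
      measurable_fst) (by fun_prop : Measurable fun a : Ω₀ × (Rn n × Rn n) =>
        a.2.1 + ε • a.2.2).stronglyMeasurable).inner measurable_snd.snd.stronglyMeasurable
  have e : (fun p => (inner ℝ (R.gradField hX (Z + ε • Y) p) (Y p) : ℝ)) =ᵐ[M]
      fun p => inner ℝ (DdF (conditionalLaw M X (Z + ε • Y : Lp (Rn n) 2 M) (X p))
        (Z p + ε • Y p)) (Y p) := by
    filter_upwards [(R.memLp_gradField hX (Z + ε • Y)).coeFn_toLp, coeFn_curve Z Y ε] with p h1 h2
    rw [gradField, h1, h2]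
  have hi := (L2.integrable_inner (𝕜 := ℝ) (R.gradField hX (Z + ε • Y)) Y).congr e
  obtain ⟨-, h2, h3⟩ := integral_condDistrib_disintegration hX (measurable_pair Z Y).aemeasurable
    hs hi
  refine ⟨h2, h3.trans ?_⟩
  rw [L2.inner_def]
  exact (integral_congr_ae e).symm

theorem hasGateauxGradientAt (R : IsRegularFunctional F C dF DdF D2dF d2F K)
    (hX : Measurable X) (Z : Lp (Rn n) 2 M) :
    HasGateauxGradientAt (fun Z : Lp (Rn n) 2 M => ∫ ω, F (conditionalLaw M X Z ω) ∂M.map X)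
      (R.gradField hX Z) Z := by
  intro Y
  set I := ∫ p, ‖Y p‖ ^ 2 ∂M
  have hY := ae_memLp_condDistrib hX (measurable_pair Z Y).aemeasurable measurable_snd (Lp.memLp Y)
  -- The bound of `norm_remainder_le` is averaged over ω; the quadratic estimate makes a dominated
  -- convergence argument unnecessary at first order.
  have key : ∀ ε : ℝ, ‖∫ ω, F (conditionalLaw M X (Z + ε • Y : Lp (Rn n) 2 M) ω) ∂M.map X -
      ∫ ω, F (conditionalLaw M X Z ω) ∂M.map X - ε * inner ℝ (R.gradField hX Z) Y‖ ≤
      ε ^ 2 * (C * I) := by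
    intro ε
    obtain ⟨i1, i2⟩ := R.integrable_inner_gradField hX Z Y 0
    simp only [zero_smul, add_zero] at i1 i2
    have hF := fun W : Lp (Rn n) 2 M => R.integrable_conditionalLaw hX (Lp.memLp W)
    rw [← i2, ← integral_const_mul, ← integral_sub (hF _) (hF _),
      ← integral_sub (f := fun ω => F (conditionalLaw M X (Z + ε • Y : Lp (Rn n) 2 M) ω) -
        F (conditionalLaw M X Z ω)) ((hF _).sub (hF _)) (i1.const_mul _)]
    rw [← show _ = I from hY.2.2, ← integral_const_mul C, ← integral_const_mul]
    refine norm_integral_le_of_norm_le ((hY.2.1.const_mul _).const_mul _) ?_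
    filter_upwards [conditionalLaw_curve_ae hX Z Y ε, conditionalLaw_fst_ae hX Z Y] with
      ω ⟨h1, e1⟩ ⟨h2, e2⟩
    have := R.norm_remainder_le h2 h1
    rw [remainder, ← e1, ← e2] at this
    simp only [add_sub_cancel_left, real_inner_smul_right, integral_const_mul, norm_smul, mul_pow,
      Real.norm_eq_abs ε, sq_abs] at this
    refine this.trans_eq ?_
    ring
  rw [tendsto_iff_norm_sub_tendsto_zero]
  have hz : Tendsto (fun ε : ℝ => |ε| * (C * I)) (𝓝[≠] 0) (𝓝 0) := by
    have : Continuous fun ε : ℝ => |ε| * (C * I) := by fun_prop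
    simpa using (this.tendsto 0).mono_left nhdsWithin_le_nhds
  refine squeeze_zero' (Eventually.of_forall fun _ => norm_nonneg _) ?_ hz
  filter_upwards [self_mem_nhdsWithin] with ε hε
  have hε : ε ≠ 0 := hε
  have hpos : 0 < |ε| := abs_pos.2 hε
  have k := key ε
  rw [← mul_le_mul_iff_right₀ hpos, ← Real.norm_eq_abs, ← norm_mul]
  calc _ = _ := by
        congr 1
        rw [mul_sub, mul_div_cancel₀ _ hε]
    _ ≤ _ := k
    _ = _ := by rw [Real.norm_eq_abs, ← sq_abs]; ring

end IsRegularFunctional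

/-! ### The second derivative as a bounded operator. -/

namespace IsRegularFunctional

variable {n : ℕ} {F : P2 n → ℝ} {C : ℝ} {dF : P2 n → Rn n → ℝ}
  {DdF : P2 n → Rn n → Rn n} {D2dF : P2 n → Rn n → Rn n →L[ℝ] Rn n}
  {d2F : P2 n → Rn n → Rn n → ℝ} {K : P2 n → Rn n → Rn n → Rn n →L[ℝ] Rn n}
  {S Ω₀ : Type*} [MeasurableSpace S] [MeasurableSpace Ω₀]
  {M : Measure S} [IsProbabilityMeasure M] {X : S → Ω₀}

theorem norm_mixed_apply_le (R : IsRegularFunctional F C dF DdF D2dF d2F K) (μ : P2 n)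
    (x x' v : Rn n) : ‖K μ x x' v‖ ≤ C * ‖v‖ :=
  ((K μ x x').le_opNorm v).trans (by gcongr; exact R.mixed_bdd _ _ _)

theorem norm_hess_apply_le (R : IsRegularFunctional F C dF DdF D2dF d2F K) (μ : P2 n)
    (x v : Rn n) : ‖D2dF μ x v‖ ≤ C * ‖v‖ :=
  ((D2dF μ x).le_opNorm v).trans (by gcongr; exact R.hess_bdd _ _)

theorem integrable_mixed (R : IsRegularFunctional F C dF DdF D2dF d2F K) {T : Type*}
    [MeasurableSpace T] {π : Measure T} [IsProbabilityMeasure π] {V Y : T → Rn n}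
    (hV : Measurable V) (hm : Measurable Y) (hY : MemLp Y 2 π) (μ : P2 n) (x : Rn n) :
    Integrable (fun t => K μ x (V t) (Y t)) π :=
  Integrable.mono' ((hY.integrable one_le_two).norm.const_mul C)
    (R.stronglyMeasurable_mixed stronglyMeasurable_const stronglyMeasurable_const
      hV.stronglyMeasurable hm.stronglyMeasurable).aestronglyMeasurable
    (Eventually.of_forall fun _ => R.norm_mixed_apply_le _ _ _ _)

/-- The average over an independent copy of the mixed derivative applied to the copy's direction. -/
noncomputable def copyAverage (K : P2 n → Rn n → Rn n → Rn n →L[ℝ] Rn n) (M : Measure S)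
    [IsProbabilityMeasure M] (X : S → Ω₀) (Z Y : S → Rn n) (a : Ω₀ × Rn n) : Rn n :=
  ∫ q, K (conditionalLaw M X Z a.1) a.2 q.1 q.2 ∂condDistrib (fun p => (Z p, Y p)) X M a.1

theorem stronglyMeasurable_copyAverage (R : IsRegularFunctional F C dF DdF D2dF d2F K)
    (Z Y : S → Rn n) : StronglyMeasurable (copyAverage K M X Z Y) := by
  have h : StronglyMeasurable (Function.uncurry fun (a : Ω₀ × Rn n) (q : Rn n × Rn n) =>
      K (conditionalLaw M X Z a.1) a.2 q.1 q.2) :=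
    R.stronglyMeasurable_mixed ((stronglyMeasurable_conditionalLaw Z).comp_measurable
      measurable_fst.fst) measurable_fst.snd.stronglyMeasurable
      measurable_snd.fst.stronglyMeasurable measurable_snd.snd.stronglyMeasurable
  exact h.integral_kernel_prod_right
    (κ := (condDistrib (fun p => (Z p, Y p)) X M).comap Prod.fst measurable_fst)

/-- The mixed derivative is bounded by C, and the rest is Jensen. The exceptional null set does not
depend on `z`, so z = Z_x(ω) may be substituted afterwards. -/
theorem norm_copyAverage_sq_le_ae (R : IsRegularFunctional F C dF DdF D2dF d2F K)
    (hX : Measurable X) (Z Y : Lp (Rn n) 2 M) :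
    ∀ᵐ ω ∂M.map X, ∀ z, ‖copyAverage K M X Z Y (ω, z)‖ ^ 2 ≤
      C ^ 2 * ∫ q, ‖q.2‖ ^ 2 ∂condDistrib (fun p => (Z p, Y p)) X M ω := by
  filter_upwards [ae_memLp_snd hX Z Y] with ω h z
  have h1 : ‖copyAverage K M X Z Y (ω, z)‖ ≤
      C * ∫ q, ‖q.2‖ ∂condDistrib (fun p => (Z p, Y p)) X M ω := by
    rw [← integral_const_mul]
    exact norm_integral_le_of_norm_le ((h.integrable one_le_two).norm.const_mul C)
      (Eventually.of_forall fun q => R.norm_mixed_apply_le _ _ _ _)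
  calc _ ≤ (C * ∫ q, ‖q.2‖ ∂condDistrib (fun p => (Z p, Y p)) X M ω) ^ 2 := by gcongr
    _ ≤ _ := by
      rw [mul_pow]
      gcongr
      exact sq_integral_norm_le h

theorem integral_sq_condDistrib (hX : Measurable X) (Z Y : Lp (Rn n) 2 M) :
    Integrable (fun p => ∫ q, ‖q.2‖ ^ 2 ∂condDistrib (fun p => (Z p, Y p)) X M (X p)) M ∧
    ∫ p, ∫ q, ‖q.2‖ ^ 2 ∂condDistrib (fun p => (Z p, Y p)) X M (X p) ∂M = ‖Y‖ ^ 2 := by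
  obtain ⟨-, h2, h3⟩ := ae_memLp_condDistrib hX (measurable_pair Z Y).aemeasurable measurable_snd
    (Lp.memLp Y)
  refine ⟨h2.comp_measurable hX, ?_⟩
  rw [integral_map hX.aemeasurable h2.1] at h3
  rw [h3, ← real_inner_self_eq_norm_sq, L2.inner_def]
  simp only [real_inner_self_eq_norm_sq]

/-- The second order Gâteaux derivative of the lifted functional, as a random field. -/
noncomputable def hessField (D2dF : P2 n → Rn n → Rn n →L[ℝ] Rn n)
    (K : P2 n → Rn n → Rn n → Rn n →L[ℝ] Rn n) (M : Measure S)
    [IsProbabilityMeasure M] (X : S → Ω₀) (Z Y : S → Rn n) (p : S) : Rn n :=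
  D2dF (conditionalLaw M X Z (X p)) (Z p) (Y p) + copyAverage K M X Z Y (X p, Z p)

theorem norm_hessField_sq_le_ae (R : IsRegularFunctional F C dF DdF D2dF d2F K)
    (hX : Measurable X) (Z Y : Lp (Rn n) 2 M) : ∀ᵐ p ∂M,
    ‖hessField D2dF K M X Z Y p‖ ^ 2 ≤ 2 * C ^ 2 * (‖Y p‖ ^ 2 +
      ∫ q, ‖q.2‖ ^ 2 ∂condDistrib (fun p => (Z p, Y p)) X M (X p)) := by
  filter_upwards [ae_of_ae_map hX.aemeasurable (R.norm_copyAverage_sq_le_ae hX Z Y)] with p h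
  have h1 := h (Z p)
  have h2 : ‖D2dF (conditionalLaw M X Z (X p)) (Z p) (Y p)‖ ^ 2 ≤ C ^ 2 * ‖Y p‖ ^ 2 := by
    rw [← mul_pow]
    gcongr
    exact R.norm_hess_apply_le _ _ _
  have h3 := norm_add_le (D2dF (conditionalLaw M X Z (X p)) (Z p) (Y p))
    (copyAverage K M X Z Y (X p, Z p))
  calc _ ≤ (‖D2dF (conditionalLaw M X Z (X p)) (Z p) (Y p)‖ +
        ‖copyAverage K M X Z Y (X p, Z p)‖) ^ 2 := by
        unfold hessField
        gcongr
    _ ≤ 2 * (‖D2dF (conditionalLaw M X Z (X p)) (Z p) (Y p)‖ ^ 2 +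
        ‖copyAverage K M X Z Y (X p, Z p)‖ ^ 2) := add_sq_le
    _ ≤ _ := by linarith

theorem stronglyMeasurable_hessFirst (R : IsRegularFunctional F C dF DdF D2dF d2F K)
    (hX : Measurable X) (Z Y : Lp (Rn n) 2 M) :
    StronglyMeasurable fun p => D2dF (conditionalLaw M X Z (X p)) (Z p) (Y p) :=
  R.stronglyMeasurable_hess ((stronglyMeasurable_conditionalLaw _).comp_measurable hX)
    (Lp.stronglyMeasurable Z) (Lp.stronglyMeasurable Y)

theorem stronglyMeasurable_copyField (R : IsRegularFunctional F C dF DdF D2dF d2F K)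
    (hX : Measurable X) (Z Y : Lp (Rn n) 2 M) :
    StronglyMeasurable fun p => copyAverage K M X Z Y (X p, Z p) :=
  (R.stronglyMeasurable_copyAverage _ _).comp_measurable
    (hX.prodMk (Lp.stronglyMeasurable Z).measurable)

theorem memLp_hessField (R : IsRegularFunctional F C dF DdF D2dF d2F K)
    (hX : Measurable X) (Z Y : Lp (Rn n) 2 M) : MemLp (hessField D2dF K M X Z Y) 2 M := by
  have hm : AEStronglyMeasurable (hessField D2dF K M X Z Y) M :=
    ((R.stronglyMeasurable_hessFirst hX Z Y).add
      (R.stronglyMeasurable_copyField hX Z Y)).aestronglyMeasurable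
  rw [memLp_two_iff_integrable_sq_norm hm]
  refine Integrable.mono' (((Lp.memLp Y).norm.integrable_sq.add
    (integral_sq_condDistrib hX Z Y).1).const_mul (2 * C ^ 2)) (hm.norm.pow 2) ?_
  filter_upwards [R.norm_hessField_sq_le_ae hX Z Y] with p h
  rw [norm_pow, norm_norm]
  exact h

theorem norm_toLp_hessField_le (R : IsRegularFunctional F C dF DdF D2dF d2F K)
    (hX : Measurable X) (Z Y : Lp (Rn n) 2 M) :
    ‖(R.memLp_hessField hX Z Y).toLp _‖ ≤ 2 * C * ‖Y‖ := by
  have hC := R.const_nonneg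
  refine abs_le_of_sq_le_sq' ?_ (by positivity) |>.2
  have h0 : ∀ W : Lp (Rn n) 2 M, ‖W‖ ^ 2 = ∫ p, ‖W p‖ ^ 2 ∂M := fun W => by
    rw [← real_inner_self_eq_norm_sq, L2.inner_def]
    simp only [real_inner_self_eq_norm_sq]
  have hY := (Lp.memLp Y).norm.integrable_sq
  obtain ⟨i, e⟩ := integral_sq_condDistrib hX Z Y
  calc _ = ∫ p, ‖hessField D2dF K M X Z Y p‖ ^ 2 ∂M := by
        rw [h0]
        refine integral_congr_ae ?_
        filter_upwards [(R.memLp_hessField hX Z Y).coeFn_toLp] with p hp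
        rw [hp]
    _ ≤ ∫ p, 2 * C ^ 2 * (‖Y p‖ ^ 2 +
        ∫ q, ‖q.2‖ ^ 2 ∂condDistrib (fun p => (Z p, Y p)) X M (X p)) ∂M :=
        integral_mono_ae (R.memLp_hessField hX Z Y).norm.integrable_sq
          ((hY.add i).const_mul _) (R.norm_hessField_sq_le_ae hX Z Y)
    -- The conditional second moment of Y averages to ‖Y‖², so the two terms together give 4C²‖Y‖².
    _ = (2 * C * ‖Y‖) ^ 2 := by
        rw [integral_const_mul, integral_add hY i, e, ← h0]
        ring

/-- The conditional law is not linear in the field. The laws of (Z,Y+Y'), (Z,Y) and (Z,Y') are all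
images of the conditional law of the triple (Z,Y,Y'); over it, additivity is that of the integrand.
-/
theorem copyAverage_add_ae (R : IsRegularFunctional F C dF DdF D2dF d2F K)
    (hX : Measurable X) (Z Y Y' : Lp (Rn n) 2 M) : ∀ᵐ ω ∂M.map X, ∀ z,
    copyAverage K M X Z (Y + Y' : Lp (Rn n) 2 M) (ω, z) =
      copyAverage K M X Z Y (ω, z) + copyAverage K M X Z Y' (ω, z) := by
  have mU : Measurable fun p => (Z p, Y p, Y' p) :=
    (Lp.stronglyMeasurable Z).measurable.prodMk (measurable_pair Y Y')
  have hc : condDistrib (fun p => (Z p, (Y + Y' : Lp (Rn n) 2 M) p)) X M =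
      condDistrib (fun p => (Z p, Y p + Y' p)) X M := by
    refine condDistrib_congr_left ?_
    filter_upwards [Lp.coeFn_add Y Y'] with p h
    rw [h, Pi.add_apply]
  filter_upwards [
    condDistrib_comp X (mU.aemeasurable (μ := M)) (f := fun r => (r.1, r.2.1 + r.2.2)) (by fun_prop),
    condDistrib_comp X (mU.aemeasurable (μ := M)) (f := fun r => (r.1, r.2.1)) (by fun_prop),
    condDistrib_comp X (mU.aemeasurable (μ := M)) (f := fun r => (r.1, r.2.2)) (by fun_prop),
    (ae_memLp_condDistrib hX (mU.aemeasurable (μ := M)) (g := fun r => r.2.1) (by fun_prop)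
      (Lp.memLp Y)).1,
    (ae_memLp_condDistrib hX (mU.aemeasurable (μ := M)) (g := fun r => r.2.2) (by fun_prop)
      (Lp.memLp Y')).1] with ω h1 h2 h3 h4 h5 z
  set κ := condDistrib (fun p => (Z p, Y p, Y' p)) X M ω with hκ
  have e : ∀ {g : Rn n × Rn n × Rn n → Rn n × Rn n} (hg : Measurable g),
      ∫ q, K (conditionalLaw M X Z ω) z q.1 q.2 ∂κ.map g =
        ∫ r, K (conditionalLaw M X Z ω) z (g r).1 (g r).2 ∂κ := fun hg =>
    integral_map hg.aemeasurable (R.stronglyMeasurable_mixed stronglyMeasurable_const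
      stronglyMeasurable_const measurable_fst.stronglyMeasurable
      measurable_snd.stronglyMeasurable).aestronglyMeasurable
  rw [Kernel.map_apply _ (by fun_prop)] at h1 h2 h3
  unfold copyAverage
  simp only [hc]
  change condDistrib (fun p => (Z p, Y p + Y' p)) X M ω = _ at h1
  change condDistrib (fun p => (Z p, Y p)) X M ω = _ at h2
  change condDistrib (fun p => (Z p, Y' p)) X M ω = _ at h3
  rw [h1, h2, h3, e (by fun_prop), e (by fun_prop), e (by fun_prop)]
  simp only [map_add]
  exact integral_add (R.integrable_mixed measurable_fst measurable_snd.fst h4 _ _)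
    (R.integrable_mixed measurable_fst measurable_snd.snd h5 _ _)

theorem copyAverage_smul_ae (R : IsRegularFunctional F C dF DdF D2dF d2F K)
    (c : ℝ) (Z Y : Lp (Rn n) 2 M) : ∀ᵐ ω ∂M.map X, ∀ z,
    copyAverage K M X Z (c • Y : Lp (Rn n) 2 M) (ω, z) = c • copyAverage K M X Z Y (ω, z) := by
  have hc : condDistrib (fun p => (Z p, (c • Y : Lp (Rn n) 2 M) p)) X M =
      condDistrib (fun p => (Z p, c • Y p)) X M := by
    refine condDistrib_congr_left ?_
    filter_upwards [Lp.coeFn_smul c Y] with p h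
    rw [h, Pi.smul_apply]
  filter_upwards [condDistrib_comp X ((measurable_pair Z Y).aemeasurable (μ := M))
    (f := fun r => (r.1, c • r.2)) (by fun_prop)] with ω h1 z
  rw [Kernel.map_apply _ (by fun_prop)] at h1
  unfold copyAverage
  simp only [hc]
  change condDistrib (fun p => (Z p, c • Y p)) X M ω = _ at h1
  rw [h1, integral_map (by fun_prop) (R.stronglyMeasurable_mixed stronglyMeasurable_const
      stronglyMeasurable_const measurable_fst.stronglyMeasurable
      measurable_snd.stronglyMeasurable).aestronglyMeasurable, ← integral_smul]
  simp only [map_smul]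

/-- The second order Gâteaux derivative of the lifted functional. -/
noncomputable def hessOperator (R : IsRegularFunctional F C dF DdF D2dF d2F K)
    (hX : Measurable X) (Z : Lp (Rn n) 2 M) : Lp (Rn n) 2 M →L[ℝ] Lp (Rn n) 2 M :=
  LinearMap.mkContinuous
    { toFun := fun Y => (R.memLp_hessField hX Z Y).toLp _
      map_add' := fun Y Y' => by
        rw [← MemLp.toLp_add]
        refine MemLp.toLp_congr _ _ ?_
        filter_upwards [Lp.coeFn_add Y Y',
          ae_of_ae_map hX.aemeasurable (R.copyAverage_add_ae hX Z Y Y')] with p h1 h2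
        simp only [hessField, h1, h2, Pi.add_apply, map_add]
        abel
      map_smul' := fun c Y => by
        rw [RingHom.id_apply, ← MemLp.toLp_const_smul]
        refine MemLp.toLp_congr _ _ ?_
        filter_upwards [Lp.coeFn_smul c Y,
          ae_of_ae_map hX.aemeasurable (R.copyAverage_smul_ae c Z Y)] with p h1 h2
        simp only [hessField, h1, h2, Pi.smul_apply, map_smul, smul_add] }
    (2 * C) (R.norm_toLp_hessField_le hX Z)

theorem hessOperator_ae (R : IsRegularFunctional F C dF DdF D2dF d2F K)
    (hX : Measurable X) (Z Y : Lp (Rn n) 2 M) :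
    R.hessOperator hX Z Y =ᵐ[M] hessField D2dF K M X Z Y :=
  (R.memLp_hessField hX Z Y).coeFn_toLp

end IsRegularFunctional

/-! ### The bilinear form of the operator, self-adjointness and the second-order limit. -/

namespace IsRegularFunctional

variable {n : ℕ} {F : P2 n → ℝ} {C : ℝ} {dF : P2 n → Rn n → ℝ}
  {DdF : P2 n → Rn n → Rn n} {D2dF : P2 n → Rn n → Rn n →L[ℝ] Rn n}
  {d2F : P2 n → Rn n → Rn n → ℝ} {K : P2 n → Rn n → Rn n → Rn n →L[ℝ] Rn n}
  {S Ω₀ : Type*} [MeasurableSpace S] [MeasurableSpace Ω₀]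
  {M : Measure S} [IsProbabilityMeasure M] {X : S → Ω₀}

theorem memLp_hessFirst (R : IsRegularFunctional F C dF DdF D2dF d2F K)
    (hX : Measurable X) (Z Y : Lp (Rn n) 2 M) :
    MemLp (fun p => D2dF (conditionalLaw M X Z (X p)) (Z p) (Y p)) 2 M :=
  MemLp.mono' ((Lp.memLp Y).norm.const_mul C)
    (R.stronglyMeasurable_hessFirst hX Z Y).aestronglyMeasurable
    (Eventually.of_forall fun _ => R.norm_hess_apply_le _ _ _)

theorem memLp_copyField (R : IsRegularFunctional F C dF DdF D2dF d2F K)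
    (hX : Measurable X) (Z Y : Lp (Rn n) 2 M) :
    MemLp (fun p => copyAverage K M X Z Y (X p, Z p)) 2 M := by
  refine ((R.memLp_hessField hX Z Y).sub (R.memLp_hessFirst hX Z Y)).ae_eq
    (Eventually.of_forall fun p => ?_)
  simp [hessField]

theorem integrable_mixed_ae (R : IsRegularFunctional F C dF DdF D2dF d2F K)
    (hX : Measurable X) (Z Y : Lp (Rn n) 2 M) : ∀ᵐ p ∂M,
    Integrable (fun q : Rn n × Rn n => K (conditionalLaw M X Z (X p)) (Z p) q.1 q.2)
      (condDistrib (fun p => (Z p, Y p)) X M (X p)) := by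
  filter_upwards [ae_of_ae_map hX.aemeasurable (ae_memLp_snd hX Z Y)] with p hp
  exact R.integrable_mixed measurable_fst measurable_snd hp _ _

theorem integrable_inner_mixed (R : IsRegularFunctional F C dF DdF D2dF d2F K)
    {π π' : Measure (Rn n × Rn n)} [IsProbabilityMeasure π] [IsProbabilityMeasure π']
    (h : MemLp Prod.snd 2 π) (h' : MemLp Prod.snd 2 π') (μ : P2 n) :
    Integrable (fun s : (Rn n × Rn n) × (Rn n × Rn n) =>
      (inner ℝ (K μ s.1.1 s.2.1 s.2.2) s.1.2 : ℝ)) (π'.prod π) := by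
  refine Integrable.mono' (((h'.integrable one_le_two).norm.mul_prod
    (h.integrable one_le_two).norm).const_mul C) ?_ (Eventually.of_forall fun s => ?_)
  · exact ((R.stronglyMeasurable_mixed stronglyMeasurable_const
      measurable_fst.fst.stronglyMeasurable measurable_snd.fst.stronglyMeasurable
      measurable_snd.snd.stronglyMeasurable).inner
      measurable_fst.snd.stronglyMeasurable).aestronglyMeasurable
  · refine (norm_inner_le_norm _ _).trans ?_
    calc _ ≤ C * ‖s.2.2‖ * ‖s.1.2‖ := by gcongr; exact R.norm_mixed_apply_le _ _ _ _
      _ = _ := by ring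

theorem integral_inner_copyAverage_ae (R : IsRegularFunctional F C dF DdF D2dF d2F K)
    (hX : Measurable X) (Z Y Y' : Lp (Rn n) 2 M) : ∀ᵐ ω ∂M.map X,
    ∫ r, (inner ℝ (copyAverage K M X Z Y (ω, r.1)) r.2 : ℝ)
      ∂condDistrib (fun p => (Z p, Y' p)) X M ω =
    ∫ s, (inner ℝ (K (conditionalLaw M X Z ω) s.1.1 s.2.1 s.2.2) s.1.2 : ℝ)
      ∂(condDistrib (fun p => (Z p, Y' p)) X M ω).prod
        (condDistrib (fun p => (Z p, Y p)) X M ω) := by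
  filter_upwards [ae_memLp_snd hX Z Y, ae_memLp_snd hX Z Y'] with ω h h'
  rw [integral_prod _ (R.integrable_inner_mixed h h' _)]
  refine integral_congr_ae (Eventually.of_forall fun r => ?_)
  simp only
  rw [real_inner_comm, copyAverage, ← integral_inner
    (R.integrable_mixed measurable_fst measurable_snd h _ _)]
  simp only [real_inner_comm]

/-- The copy term becomes a double integral against a product of conditional laws: conditional
independence of the copy in a form where the two factors can be exchanged. -/
theorem inner_hessOperator (R : IsRegularFunctional F C dF DdF D2dF d2F K)
    (hX : Measurable X) (Z Y Y' : Lp (Rn n) 2 M) :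
    Integrable (fun ω => ∫ s,
      (inner ℝ (K (conditionalLaw M X Z ω) s.1.1 s.2.1 s.2.2) s.1.2 : ℝ)
      ∂(condDistrib (fun p => (Z p, Y' p)) X M ω).prod
        (condDistrib (fun p => (Z p, Y p)) X M ω)) (M.map X) ∧
    inner ℝ (R.hessOperator hX Z Y) Y' =
      ∫ p, (inner ℝ (D2dF (conditionalLaw M X Z (X p)) (Z p) (Y p)) (Y' p) : ℝ) ∂M +
      ∫ ω, ∫ s, (inner ℝ (K (conditionalLaw M X Z ω) s.1.1 s.2.1 s.2.2) s.1.2 : ℝ)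
        ∂(condDistrib (fun p => (Z p, Y' p)) X M ω).prod
          (condDistrib (fun p => (Z p, Y p)) X M ω) ∂M.map X := by
  have hs : StronglyMeasurable fun a : Ω₀ × (Rn n × Rn n) =>
      (inner ℝ (copyAverage K M X Z Y (a.1, a.2.1)) a.2.2 : ℝ) :=
    ((R.stronglyMeasurable_copyAverage _ _).comp_measurable
      (measurable_fst.prodMk measurable_snd.fst)).inner measurable_snd.snd.stronglyMeasurable
  have i1 := integrable_inner_of_memLp (R.memLp_hessFirst hX Z Y) (Lp.memLp Y')
  have i2 := integrable_inner_of_memLp (R.memLp_copyField hX Z Y) (Lp.memLp Y')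
  obtain ⟨-, h2, h3⟩ := integral_condDistrib_disintegration hX (measurable_pair Z Y').aemeasurable
    hs i2
  have hc := R.integral_inner_copyAverage_ae hX Z Y Y'
  refine ⟨h2.congr hc, ?_⟩
  rw [← integral_congr_ae hc, h3, ← integral_add i1 i2, L2.inner_def]
  refine integral_congr_ae ?_
  filter_upwards [R.hessOperator_ae hX Z Y] with p hp
  rw [hp, hessField, inner_add_left]

theorem isSelfAdjoint_hessOperator (R : IsRegularFunctional F C dF DdF D2dF d2F K)
    (hX : Measurable X) (hsymm : ∀ μ x x', d2F μ x x' = d2F μ x' x) (Z : Lp (Rn n) 2 M) :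
    IsSelfAdjoint (R.hessOperator hX Z) := by
  rw [ContinuousLinearMap.isSelfAdjoint_iff_isSymmetric]
  intro Y Y'
  change inner ℝ (R.hessOperator hX Z Y) Y' = inner ℝ Y (R.hessOperator hX Z Y')
  rw [real_inner_comm (R.hessOperator hX Z Y') Y, (R.inner_hessOperator hX Z Y Y').2,
    (R.inner_hessOperator hX Z Y' Y).2]
  congr 1
  · simp only [R.inner_hess_comm _ _ (Y _)]
  · refine integral_congr_ae (Eventually.of_forall fun ω => ?_)
    simp only
    -- Exchanging the original and the copy interchanges the roles of Y and Y'.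
    rw [← integral_prod_swap]
    simp only [Prod.fst_swap, Prod.snd_swap]
    refine integral_congr_ae (Eventually.of_forall fun s => ?_)
    exact R.inner_mixed_comm hsymm _ _ _ _ _

theorem inner_hessOperator_self (R : IsRegularFunctional F C dF DdF D2dF d2F K)
    (hX : Measurable X) (Z Y : Lp (Rn n) 2 M) :
    inner ℝ (R.hessOperator hX Z Y) Y = ∫ ω, secondVariation D2dF K
      (condDistrib (fun p => (Z p, Y p)) X M ω) (conditionalLaw M X Z ω) Prod.fst Prod.snd
      ∂M.map X := by
  have hs : StronglyMeasurable fun a : Ω₀ × (Rn n × Rn n) =>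
      (inner ℝ (D2dF (conditionalLaw M X Z a.1) a.2.1 a.2.2) a.2.2 : ℝ) :=
    (R.stronglyMeasurable_hess ((stronglyMeasurable_conditionalLaw _).comp_measurable
      measurable_fst) measurable_snd.fst.stronglyMeasurable
      measurable_snd.snd.stronglyMeasurable).inner measurable_snd.snd.stronglyMeasurable
  have i1 := integrable_inner_of_memLp (R.memLp_hessFirst hX Z Y) (Lp.memLp Y)
  obtain ⟨-, h2, h3⟩ := integral_condDistrib_disintegration hX (measurable_pair Z Y).aemeasurable
    hs i1
  obtain ⟨h4, h5⟩ := R.inner_hessOperator hX Z Y Y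
  rw [h5, ← h3, ← integral_add h2 h4]
  rfl

theorem tendsto_inner_gradField (R : IsRegularFunctional F C dF DdF D2dF d2F K)
    (hX : Measurable X) (Z Y : Lp (Rn n) 2 M) :
    Tendsto (fun ε : ℝ => inner ℝ (R.gradField hX (Z + ε • Y) - R.gradField hX Z) Y / ε)
      (𝓝[≠] 0) (𝓝 (inner ℝ (R.hessOperator hX Z Y) Y)) := by
  classical
  let κ := condDistrib (fun p => (Z p, Y p)) X M
  -- The identity with the conditional law of Z + εY holds off a null set depending on ε. `f` is a
  -- version given by the first variation for all ε at once, off a single null set, so that the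
  -- pointwise limit in ε makes sense.
  let f : ℝ → Ω₀ → ℝ := fun ε ω =>
    if h : MemLp Prod.fst 2 (κ ω) ∧ MemLp Prod.snd 2 (κ ω) then
      firstVariation DdF (κ ω) h.1 h.2 ε else 0
  have hfst := ae_memLp_fst hX Z Y
  have hsnd := ae_memLp_snd hX Z Y
  have hf : ∀ ε, (fun ω => ∫ q, (inner ℝ (DdF (conditionalLaw M X (Z + ε • Y : Lp (Rn n) 2 M) ω)
      (q.1 + ε • q.2)) q.2 : ℝ) ∂κ ω) =ᵐ[M.map X] f ε := by
    intro ε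
    filter_upwards [hfst, hsnd, conditionalLaw_curve_ae hX Z Y ε] with ω h1 h2 ⟨h3, e⟩
    simp only [f]
    rw [dif_pos ⟨h1, h2⟩, e]
    rfl
  have hi : ∀ ε, Integrable (f ε) (M.map X) := fun ε =>
    (R.integrable_inner_gradField hX Z Y ε).1.congr (hf ε)
  have hint : ∀ ε, ∫ ω, f ε ω ∂M.map X = inner ℝ (R.gradField hX (Z + ε • Y)) Y := fun ε => by
    rw [← (R.integrable_inner_gradField hX Z Y ε).2]
    exact integral_congr_ae (hf ε).symm
  have h0 := hint 0
  rw [zero_smul, add_zero] at h0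
  have hq : ∀ ε : ℝ, inner ℝ (R.gradField hX (Z + ε • Y) - R.gradField hX Z) Y / ε =
      ∫ ω, ε⁻¹ * (f ε ω - f 0 ω) ∂M.map X := fun ε => by
    rw [inner_sub_left, ← hint, ← h0, integral_const_mul, integral_sub (hi _) (hi _)]
    ring
  simp only [hq]
  rw [R.inner_hessOperator_self]
  have hY := ae_memLp_condDistrib hX (measurable_pair Z Y).aemeasurable measurable_snd (Lp.memLp Y)
  refine tendsto_integral_filter_of_dominated_convergence
    (fun ω => 2 * C * ∫ q, ‖q.2‖ ^ 2 ∂κ ω)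
    (Eventually.of_forall fun ε => (((hi ε).sub (hi 0)).const_mul _).1) ?_
    (hY.2.1.const_mul _) ?_
  · filter_upwards [self_mem_nhdsWithin] with ε hε
    filter_upwards [hfst, hsnd] with ω h1 h2
    simp only [f]
    rw [dif_pos ⟨h1, h2⟩, dif_pos ⟨h1, h2⟩]
    exact R.norm_firstVariation_sub_le h1 h2 hε
  · filter_upwards [hsnd, conditionalLaw_fst_ae hX Z Y] with ω h2 ⟨h1, e⟩
    have hω : ∀ ε, f ε ω = firstVariation DdF (κ ω) h1 h2 ε := fun ε => dif_pos ⟨h1, h2⟩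
    simp only [hω]
    rw [e]
    exact R.tendsto_firstVariation h1 h2

theorem hasSecondGateauxDerivAt (R : IsRegularFunctional F C dF DdF D2dF d2F K)
    (hX : Measurable X) (Z : Lp (Rn n) 2 M) :
    HasSecondGateauxDerivAt
      (fun Z : Lp (Rn n) 2 M => ∫ ω, F (conditionalLaw M X Z ω) ∂M.map X)
      (R.hessOperator hX Z) Z :=
  ⟨R.gradField hX, R.hasGateauxGradientAt hX, R.tendsto_inner_gradField hX Z⟩

end IsRegularFunctional

/-! ### Specialisation to Ω × ℝⁿ with its projection to (Ω, ℬ). -/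

theorem proposition2p2 {n : ℕ} {Ω : Type*} (B : MeasurableSpace Ω) [mΩ : MeasurableSpace Ω]
    (hB : B ≤ mΩ) (P : Measure Ω) [IsProbabilityMeasure P] (m : P2 n)
    (F : P2 n → ℝ) (C : ℝ)
    -- `F` is continuous with at most quadratic growth
    (hF_cont : Continuous F)
    (hF_growth : ∀ μ : P2 n, |F μ| ≤ C * (1 + ∫ x, ‖x‖ ^ 2 ∂(μ : Measure (Rn n))))
    -- the functional derivative of `F` and its gradient `D dF/dν`
    (dF : P2 n → Rn n → ℝ) (hdF : IsFunctionalDerivative F dF)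
    (hdF_growth : ∀ μ x, |dF μ x| ≤ C * (1 + ‖x‖ ^ 2))
    (DdF : P2 n → Rn n → Rn n) (hDdF : ∀ μ x, HasGradientAt (dF μ) (DdF μ x) x)
    (hDdF_cont : Continuous fun p : P2 n × Rn n => DdF p.1 p.2)
    (hDdF_growth : ∀ μ x, ‖DdF μ x‖ ≤ C * √(1 + ‖x‖ ^ 2))
    (hDdF_lip : ∀ μ x₁ x₂, ‖DdF μ x₁ - DdF μ x₂‖ ≤ C * ‖x₁ - x₂‖)
    -- `D² dF/dν`
    (D2dF : P2 n → Rn n → Rn n →L[ℝ] Rn n)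
    (hD2dF : ∀ μ x, HasFDerivAt (DdF μ) (D2dF μ x) x)
    (hD2dF_cont : Continuous fun p : P2 n × Rn n => D2dF p.1 p.2)
    (hD2dF_bdd : ∀ μ x, ‖D2dF μ x‖ ≤ C)
    -- the second-order functional derivative of `F` and `D D₁ d²F/dν²`
    (d2F : P2 n → Rn n → Rn n → ℝ) (hd2F : IsSecondFunctionalDerivative F d2F)
    (DD₁d2F : P2 n → Rn n → Rn n → Rn n →L[ℝ] Rn n)
    (hDD₁ : ∀ μ, IsMixedHessian (d2F μ) (DD₁d2F μ))
    (hDD₁_cont : Continuous fun p : P2 n × Rn n × Rn n => DD₁d2F p.1 p.2.1 p.2.2)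
    (hDD₁_bdd : ∀ μ x x₁, ‖DD₁d2F μ x x₁‖ ≤ C) :
    (∀ Z : Hm P m, Integrable (fun ω => F (condLaw B P m Z ω)) P) ∧
    ∃ D2 : Hm P m → (Hm P m →L[ℝ] Hm P m),
      (∀ Z : Hm P m, HasSecondGateauxDerivAt (condFunctional B P m F) (D2 Z) Z) ∧
      (∀ Z Y : Hm P m,
        (∀ᵐ p ∂(P.prod (m : Measure (Rn n))),
          Integrable (fun q : Rn n × Rn n => DD₁d2F (condLaw B P m Z p.1) (Z p) q.1 q.2)
            (condCopyLaw B P m Z Y p.1)) ∧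
        ∀ᵐ p ∂(P.prod (m : Measure (Rn n))),
          (D2 Z Y) p = D2dF (condLaw B P m Z p.1) (Z p) (Y p) +
            ∫ q, DD₁d2F (condLaw B P m Z p.1) (Z p) q.1 q.2 ∂(condCopyLaw B P m Z Y p.1)) ∧
      ((∀ μ x x₁, d2F μ x x₁ = d2F μ x₁ x) → ∀ Z : Hm P m, IsSelfAdjoint (D2 Z)) := by
  have R : IsRegularFunctional F C dF DdF D2dF d2F DD₁d2F :=
    { cont := hF_cont, growth := hF_growth, first := hdF, grad := hDdF, grad_cont := hDdF_cont
      grad_growth := hDdF_growth, hess := hD2dF, hess_cont := hD2dF_cont, hess_bdd := hD2dF_bdd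
      second := hd2F, mixed := hDD₁, mixed_cont := hDD₁_cont, mixed_bdd := hDD₁_bdd }
  have hX : @Measurable (Ω × Rn n) Ω _ B Prod.fst := measurable_fst.mono le_rfl hB
  -- The general results integrate over the law of the conditioning variable, here ℙ restricted to
  -- ℬ. Since F((Z⊗m)^ℬ) is ℬ-measurable, its integral is the same under ℙ.
  have hmap : @Measure.map (Ω × Rn n) Ω _ B Prod.fst (P.prod (m : Measure (Rn n))) =
      P.trim hB := by
    refine @Measure.ext _ B _ _ fun s hs => ?_
    rw [Measure.map_apply hX hs, trim_measurableSet_eq hB hs,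
      ← Measure.map_apply measurable_fst (hB s hs), Measure.map_fst_prod]
    simp
  have hlaw : ∀ Z : Hm P m, condLaw B P m Z = @conditionalLaw n (Ω × Rn n) Ω _ B
      (P.prod (m : Measure (Rn n))) _ Prod.fst Z := fun Z => rfl
  have hsm : ∀ Z : Hm P m, StronglyMeasurable[B] fun ω => F (condLaw B P m Z ω) := fun Z =>
    R.cont.comp_stronglyMeasurable (@stronglyMeasurable_conditionalLaw n (Ω × Rn n) Ω _ B
      (P.prod (m : Measure (Rn n))) _ Prod.fst Z)
  have hΦ : condFunctional B P m F = fun Z : Hm P m => ∫ ω, F (@conditionalLaw n (Ω × Rn n) Ω _ B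
      (P.prod (m : Measure (Rn n))) _ Prod.fst Z ω) ∂(@Measure.map (Ω × Rn n) Ω _ B Prod.fst
        (P.prod (m : Measure (Rn n)))) := by
    funext Z
    rw [hmap]
    exact integral_trim hB (hsm Z)
  refine ⟨fun Z => ?_, @IsRegularFunctional.hessOperator n F C dF DdF D2dF d2F DD₁d2F (Ω × Rn n) Ω
    _ B (P.prod (m : Measure (Rn n))) _ Prod.fst R hX, fun Z => ?_, fun Z Y => ⟨?_, ?_⟩,
    fun hsymm Z => ?_⟩
  · have h := @IsRegularFunctional.integrable_conditionalLaw n F C dF DdF D2dF d2F DD₁d2F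
      (Ω × Rn n) Ω _ B (P.prod (m : Measure (Rn n))) _ Prod.fst R hX Z (Lp.memLp Z)
    rw [hmap] at h
    exact integrable_of_integrable_trim hB h
  · rw [hΦ]
    exact @IsRegularFunctional.hasSecondGateauxDerivAt n F C dF DdF D2dF d2F DD₁d2F
      (Ω × Rn n) Ω _ B (P.prod (m : Measure (Rn n))) _ Prod.fst R hX Z
  · exact @IsRegularFunctional.integrable_mixed_ae n F C dF DdF D2dF d2F DD₁d2F
      (Ω × Rn n) Ω _ B (P.prod (m : Measure (Rn n))) _ Prod.fst R hX Z Y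
  · exact @IsRegularFunctional.hessOperator_ae n F C dF DdF D2dF d2F DD₁d2F
      (Ω × Rn n) Ω _ B (P.prod (m : Measure (Rn n))) _ Prod.fst R hX Z Y
  · exact @IsRegularFunctional.isSelfAdjoint_hessOperator n F C dF DdF D2dF d2F DD₁d2F
      (Ω × Rn n) Ω _ B (P.prod (m : Measure (Rn n))) _ Prod.fst R hX hsymm Z
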